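/- Fix $P_1,P_2,N>0$ and $1\le a\le 1+P_2/N$. Consider the strong Gaussian Z-interference channel $$Y_1=X_1+Z,\qquad Y_2=X_2+\sqrt a\,X_1+Z,$$ where $Z$ is white Gaussian noise in $\mathbb R^n$ with power $N$ per component. For each block length $n$, a code consists of independent messages $W_1,W_2$, where $W_i$ is uniform on a set of $M_i\ge 1$ elements, of encoding functions mapping $W_i$ to codewords $X_i\in\mathbb R^n$ with $\|X_i\|^2\le nP_i$ (Euclidean norm), and of (measurable) decoding functions mapping $Y_i$ to an estimate $\hat W_i$ of $W_i$; $(W_1,W_2)$ is independent of $Z$. The rates are $R_i=\frac1n\log M_i$ (natural logarithm). A sequence of codes, one for each $n$, is called reliable if $\mathbb P\{\hat W_i\neq W_i\}\to0$ as $n\to\infty$ for $i=1,2$; a rate pair is achievable if it is the limit of the rate pairs $(R_1,R_2)$ of some reliable sequence. For real sequences write $A_n\lesssim B_n$ if $A_n\le B_n+n\epsilon(n)$ for all $n\geq 1$, for some positive function $\epsilon(n)\to0$. Let $C_i=\frac12\log(1+P_i/N)$. Put $$C_1'=\frac12\log\Bigl(1+\frac{aP_1+P_2}{N}\Bigr)-C_2=\frac12\log\Bigl(1+\frac{aP_1}{P_2+N}\Bigr),$$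 $$C_2'=\frac12\log\Bigl(1+\frac{aP_1+P_2}{N}\Bigr)-C_1=\frac12\log\Bigl(1+\frac{(a-1)P_1+P_2}{P_1+N}\Bigr)$$ (in each line the two expressions agree). Then $(C_1,C_2')$ and $(C_1',C_2)$ are the corner points of the capacity region, in the following sense: both pairs are achievable, and for every reliable sequence of codes, $$nC_1\lesssim nR_1\ \Longrightarrow\ nR_2\lesssim nC_2',\qquad\qquad nC_2\lesssim nR_2\ \Longrightarrow\ nR_1\lesssim nC_1'.$$ -/

import Mathlib

open MeasureTheory ProbabilityTheory Filter Topology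

namespace GaussianZIC

/-- Almost inequality between real sequences: `A n ≤ B n + n * ε n` for all dimensions `n ≥ 1`,
for some positive function `ε` of `n` which tends to `0`. -/
def AlmostLE (A B : ℕ → ℝ) : Prop :=
  ∃ ε : ℕ → ℝ, (∀ n, 0 < ε n) ∧ Tendsto ε atTop (𝓝 0) ∧ ∀ n : ℕ, 1 ≤ n → A n ≤ B n + n * ε n

/-- White Gaussian noise in `ℝⁿ` with power `N` per component (law with independent
`𝒩(0, N)` coordinates). -/
noncomputable def noise (n : ℕ) (N : ℝ) : Measure (Fin n → ℝ) :=
  Measure.pi fun _ => gaussianReal 0 N.toNNReal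

/-- A code of block length `n` for a two-user channel with power constraints `P₁`, `P₂`:
sender `i` has an `Mᵢ`-ary message, its encoder maps every message to a codeword `x` in `ℝⁿ`
whose squared Euclidean norm is at most `n Pᵢ`, and decoder `i` maps the channel output in `ℝⁿ`
to an `Mᵢ`-ary message. -/
structure Code (n : ℕ) (P₁ P₂ : ℝ) where
  M₁ : ℕ
  M₂ : ℕ
  M₁_pos : 0 < M₁
  M₂_pos : 0 < M₂
  enc₁ : Fin M₁ → Fin n → ℝ
  enc₂ : Fin M₂ → Fin n → ℝ
  power₁ : ∀ w, ∑ i, enc₁ w i ^ 2 ≤ n * P₁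
  power₂ : ∀ w, ∑ i, enc₂ w i ^ 2 ≤ n * P₂
  dec₁ : (Fin n → ℝ) → Fin M₁
  dec₂ : (Fin n → ℝ) → Fin M₂
  measurable_dec₁ : Measurable dec₁
  measurable_dec₂ : Measurable dec₂

namespace Code

variable {n : ℕ} {P₁ P₂ : ℝ}

/-- The rate `R₁`, in nats per channel use: `M₁ = exp (n R₁)`. -/
noncomputable def R₁ (c : Code n P₁ P₂) : ℝ := Real.log c.M₁ / n

/-- The rate `R₂`, in nats per channel use: `M₂ = exp (n R₂)`. -/
noncomputable def R₂ (c : Code n P₁ P₂) : ℝ := Real.log c.M₂ / n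

/-- The joint law of `(W₁, W₂, Z)`: independent, with `W₁`, `W₂` uniformly distributed messages
and `Z` white Gaussian noise of power `N`. -/
noncomputable def law (c : Code n P₁ P₂) (N : ℝ) :
    Measure (Fin c.M₁ × Fin c.M₂ × (Fin n → ℝ)) :=
  (uniformOn (Set.univ : Set (Fin c.M₁))).prod
    ((uniformOn (Set.univ : Set (Fin c.M₂))).prod (noise n N))

/-- First output of the Z-interference channel, `Y₁ = X₁ + Z`. -/
def Y₁ (c : Code n P₁ P₂) (ω : Fin c.M₁ × Fin c.M₂ × (Fin n → ℝ)) : Fin n → ℝ :=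
  c.enc₁ ω.1 + ω.2.2

/-- Second output of the Z-interference channel, `Y₂ = X₂ + √a X₁ + Z`. -/
noncomputable def Y₂ (c : Code n P₁ P₂) (a : ℝ) (ω : Fin c.M₁ × Fin c.M₂ × (Fin n → ℝ)) :
    Fin n → ℝ :=
  c.enc₂ ω.2.1 + √a • c.enc₁ ω.1 + ω.2.2

/-- Probability that the first decoded message differs from `W₁`. -/
noncomputable def error₁ (c : Code n P₁ P₂) (N : ℝ) : ℝ :=
  (c.law N).real {ω | c.dec₁ (c.Y₁ ω) ≠ ω.1}

/-- Probability that the second decoded message differs from `W₂`. -/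
noncomputable def error₂ (c : Code n P₁ P₂) (N a : ℝ) : ℝ :=
  (c.law N).real {ω | c.dec₂ (c.Y₂ a ω) ≠ ω.2.1}

end Code

/-- A sequence of codes, one for every block length, is reliable if both error probabilities
tend to `0` as the block length tends to infinity. -/
def Reliable {P₁ P₂ : ℝ} (N a : ℝ) (c : (n : ℕ) → Code n P₁ P₂) : Prop :=
  Tendsto (fun n => (c n).error₁ N) atTop (𝓝 0) ∧
    Tendsto (fun n => (c n).error₂ N a) atTop (𝓝 0)

/-- The capacity region of the Gaussian Z-interference channel: all limits of the rate pairs of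
reliable sequences of codes. -/
def capacityRegion (P₁ P₂ N a : ℝ) : Set (ℝ × ℝ) :=
  {R | ∃ c : (n : ℕ) → Code n P₁ P₂, Reliable N a c ∧
    Tendsto (fun n => ((c n).R₁, (c n).R₂)) atTop (𝓝 R)}

/-- The interference-free capacity `½ log (1 + P / N)`. -/
noncomputable def capacity (P N : ℝ) : ℝ := 1 / 2 * Real.log (1 + P / N)

/-- `(C₁, C₂')` is a corner point, where `C₁` is the interference-free capacity of the first
transmission: it is achievable, and every reliable sequence of codes whose first rate is
almost at least `C₁` has its second rate almost at most `C₂'`. -/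
def IsCornerPointAtC₁ (P₁ P₂ N a C₂' : ℝ) : Prop :=
  (capacity P₁ N, C₂') ∈ capacityRegion P₁ P₂ N a ∧
    ∀ c : (n : ℕ) → Code n P₁ P₂, Reliable N a c →
      AlmostLE (fun n => n * capacity P₁ N) (fun n => n * (c n).R₁) →
        AlmostLE (fun n => n * (c n).R₂) (fun n => n * C₂')

/-- `(C₁', C₂)` is a corner point, where `C₂` is the interference-free capacity of the second
transmission: it is achievable, and every reliable sequence of codes whose second rate is
almost at least `C₂` has its first rate almost at most `C₁'`. -/
def IsCornerPointAtC₂ (P₁ P₂ N a C₁' : ℝ) : Prop :=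
  (C₁', capacity P₂ N) ∈ capacityRegion P₁ P₂ N a ∧
    ∀ c : (n : ℕ) → Code n P₁ P₂, Reliable N a c →
      AlmostLE (fun n => n * capacity P₂ N) (fun n => n * (c n).R₂) →
        AlmostLE (fun n => n * (c n).R₁) (fun n => n * C₁')

end GaussianZIC

/-!
Both corner points come from the multiple-access channel seen by the second receiver, whose sum
capacity is `S = ½ log (1 + (a P₁ + P₂) / N)`.

*Converse.* Since `a ≥ 1`, the second receiver, having decoded `W₂` and subtracted `X₂`, observes
`X₁` in noise of power `N / a ≤ N`; the decoder of the first receiver therefore recovers `W₁` as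
well (`Code.exists_shift`). So both messages are decoded from `Y₂`, and Fano's inequality
(`sum_correct_mul_log_card_le`), with a Gaussian reference law of power `a P₁ + P₂ + N` for the
output, gives `R₁ + R₂ ≤ S + o(1)` (`Code.sum_rate_le`). A user whose rate is almost at least its
capacity `Cᵢ` leaves at most `S - Cᵢ` to the other.

*Achievability.* Because `a ≤ 1 + P₂ / N`, we have `S ≤ C₁ + C₂`, and both points lie in the
pentagon `R₁ ≤ C₁`, `R₂ ≤ C₂`, `R₁ + R₂ ≤ S`. Every positive pair in the pentagon is achieved
(`mem_capacityRegion`) by random coding: codewords are Gaussian of slightly smaller power,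
conditioned on the power constraint, and the receivers compare information densities with
thresholds, the second receiver doing so jointly for both messages. A codeword unrelated to the
output passes the threshold `γ` with probability at most `exp (-γ)` (`noise_lt_infoDensity_le`),
and the transmitted one passes it by the weak law of large numbers (`tendsto_missProb`).

All densities are those of white Gaussian noise shifted by a codeword with respect to white noise of
another power (`noise_map_const_add`).
-/

namespace GaussianZIC

open scoped ENNReal

/-! ### White Gaussian noise -/

/-- Squared Euclidean norm of `x : Fin n → ℝ` (whose Mathlib norm is the sup norm). -/
def normSq {n : ℕ} (x : Fin n → ℝ) : ℝ := ∑ i, x i ^ 2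

lemma measurable_normSq {n : ℕ} : Measurable (normSq : (Fin n → ℝ) → ℝ) := by
  unfold normSq; fun_prop

instance {n : ℕ} {N : ℝ} : IsProbabilityMeasure (noise n N) := by
  unfold noise; infer_instance

/-- Independent white Gaussian noises add up to white noise whose power is the sum. -/
lemma noise_prod_map_add (n : ℕ) {Q N : ℝ} (hQ : 0 ≤ Q) (hN : 0 ≤ N) :
    ((noise n Q).prod (noise n N)).map (fun p => p.1 + p.2) = noise n (Q + N) := by
  unfold noise
  rw [← (measurePreserving_arrowProdEquivProdArrow ℝ ℝ (Fin n)
    (fun _ => gaussianReal 0 Q.toNNReal) (fun _ => gaussianReal 0 N.toNNReal)).map_eq,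
    Measure.map_map (by fun_prop) (MeasurableEquiv.measurable _)]
  have h : ((fun p : (Fin n → ℝ) × (Fin n → ℝ) => p.1 + p.2) ∘
      (MeasurableEquiv.arrowProdEquivProdArrow ℝ ℝ (Fin n))) =
      fun f i => (fun q : ℝ × ℝ => q.1 + q.2) (f i) := rfl
  rw [h, Measure.pi_map_pi (f := fun _ (q : ℝ × ℝ) => q.1 + q.2) (fun _ => by fun_prop)]
  congr 1
  ext1 _
  have := gaussianReal_conv_gaussianReal (m₁ := 0) (m₂ := 0) (v₁ := Q.toNNReal)
    (v₂ := N.toNNReal)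
  rw [Measure.conv] at this
  rw [this, Real.toNNReal_add hQ hN, add_zero]

/-- Scaling white noise by `c` multiplies its power by `c²`. -/
lemma noise_map_smul (n : ℕ) (c N : ℝ) :
    (noise n N).map (fun x => c • x) = noise n (c ^ 2 * N) := by
  unfold noise
  have h : (fun x : Fin n → ℝ => c • x) = fun x i => (fun y : ℝ => c * y) (x i) := rfl
  rw [h, Measure.pi_map_pi (f := fun _ (y : ℝ) => c * y) (fun _ => by fun_prop)]
  congr 1
  ext1 _
  rw [gaussianReal_map_const_mul, mul_zero]
  congr 1
  rw [Real.toNNReal_mul (sq_nonneg c), Real.toNNReal_of_nonneg (sq_nonneg c)]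

/-- The information density `log (dP_{u + Z} / dP_Y) y` of the Gaussian channel with noise `Z` of
power `N` and output `Y` of power `s`, for the codeword `u`. -/
noncomputable def infoDensity {n : ℕ} (s N : ℝ) (u y : Fin n → ℝ) : ℝ :=
  normSq y / (2 * s) - normSq (y - u) / (2 * N) + n * (1 / 2 * Real.log (s / N))

@[fun_prop]
lemma measurable_infoDensity {n : ℕ} {α : Type*} [MeasurableSpace α] {u y : α → Fin n → ℝ}
    (s N : ℝ) (hu : Measurable u) (hy : Measurable y) :
    Measurable (fun x => infoDensity s N (u x) (y x)) := by
  unfold infoDensity normSq; fun_prop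

lemma gaussianPDF_mul_exp {s N : ℝ} (hs : 0 < s) (hN : 0 < N) (u y : ℝ) :
    gaussianPDF 0 s.toNNReal y *
      ENNReal.ofReal (Real.exp (y ^ 2 / (2 * s) - (y - u) ^ 2 / (2 * N) +
        1 / 2 * Real.log (s / N))) = gaussianPDF u N.toNNReal y := by
  rw [gaussianPDF, gaussianPDF, ← ENNReal.ofReal_mul (gaussianPDFReal_nonneg _ _ _)]
  congr 1
  have h : Real.exp (1 / 2 * Real.log (s / N)) = √s / √N := by
    rw [← Real.sqrt_div hs.le, Real.sqrt_eq_rpow, Real.rpow_def_of_pos (div_pos hs hN), mul_comm]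
  rw [Real.exp_add, h, gaussianPDFReal, gaussianPDFReal, Real.coe_toNNReal _ hs.le,
    Real.coe_toNNReal _ hN.le]
  have h2 : Real.exp (y ^ 2 / (2 * s) - (y - u) ^ 2 / (2 * N)) =
      Real.exp (y ^ 2 / (2 * s)) * Real.exp (-(y - u) ^ 2 / (2 * N)) := by
    rw [← Real.exp_add]; ring_nf
  have h3 : Real.exp (-(y - 0) ^ 2 / (2 * s)) * Real.exp (y ^ 2 / (2 * s)) = 1 := by
    rw [← Real.exp_add, ← Real.exp_zero]; ring_nf
  rw [h2, Real.sqrt_mul (by positivity) s, Real.sqrt_mul (by positivity) N]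
  have := Real.sqrt_pos.2 hs
  have := Real.sqrt_pos.2 hN
  have := Real.sqrt_pos.2 (by positivity : 0 < 2 * Real.pi)
  calc _ = (√(2 * Real.pi) * √N)⁻¹ * (√s / √s) * (Real.exp (-(y - 0) ^ 2 / (2 * s)) *
        Real.exp (y ^ 2 / (2 * s))) * Real.exp (-(y - u) ^ 2 / (2 * N)) := by
          field_simp
    _ = _ := by rw [h3, div_self (by positivity)]; ring

/-- `exp (infoDensity s N u ·)` is the density of `u + Z`, for `Z` of power `N`, with respect to
white noise of power `s`. -/
lemma noise_map_const_add {n : ℕ} {s N : ℝ} (hs : 0 < s) (hN : 0 < N) (u : Fin n → ℝ) :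
    (noise n N).map (fun z => u + z) =
      (noise n s).withDensity (fun y => ENNReal.ofReal (Real.exp (infoDensity s N u y))) := by
  have h0 : (noise n N).map (fun z => u + z) =
      Measure.pi fun i => gaussianReal (u i) N.toNNReal := by
    unfold noise
    have h : (fun z : Fin n → ℝ => u + z) = fun z i => (fun t : ℝ => u i + t) (z i) := rfl
    rw [h, Measure.pi_map_pi (f := fun i (t : ℝ) => u i + t) (fun _ => by fun_prop)]
    congr 1
    ext1 i
    rw [gaussianReal_map_const_add, zero_add]
  have hs' : s.toNNReal ≠ 0 := by simpa using hs
  have hN' : N.toNNReal ≠ 0 := by simpa using hN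
  rw [h0]
  refine Measure.pi_eq fun B hB => ?_
  rw [withDensity_apply _ (MeasurableSet.univ_pi hB),
    ← lintegral_indicator (MeasurableSet.univ_pi hB)]
  set d : Fin n → ℝ → ℝ≥0∞ := fun i y => (B i).indicator (fun y => ENNReal.ofReal (Real.exp
    (y ^ 2 / (2 * s) - (y - u i) ^ 2 / (2 * N) + 1 / 2 * Real.log (s / N)))) y with hd
  have hdm : ∀ i, Measurable (d i) := fun i => by
    refine Measurable.indicator ?_ (hB i)
    fun_prop
  have h1 : ∀ y : Fin n → ℝ, (Set.univ.pi B).indicator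
      (fun y => ENNReal.ofReal (Real.exp (infoDensity s N u y))) y = ∏ i, d i (y i) := by
    intro y
    by_cases hy : y ∈ Set.univ.pi B
    · rw [Set.indicator_of_mem hy]
      have : ∀ i, d i (y i) = ENNReal.ofReal (Real.exp
          (y i ^ 2 / (2 * s) - (y i - u i) ^ 2 / (2 * N) + 1 / 2 * Real.log (s / N))) := fun i => by
        rw [hd]; exact Set.indicator_of_mem (hy i (Set.mem_univ i)) _
      simp_rw [this]
      rw [← ENNReal.ofReal_prod_of_nonneg (fun _ _ => (Real.exp_pos _).le), ← Real.exp_sum]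
      congr 2
      rw [Finset.sum_add_distrib, Finset.sum_sub_distrib, ← Finset.sum_div, ← Finset.sum_div]
      simp [infoDensity, normSq]
    · rw [Set.indicator_of_notMem hy]
      obtain ⟨i, hi⟩ : ∃ i, y i ∉ B i := by simpa [Set.mem_pi] using hy
      refine (Finset.prod_eq_zero (Finset.mem_univ i) ?_).symm
      rw [hd]; exact Set.indicator_of_notMem hi _
  simp_rw [h1]
  unfold noise
  rw [lintegral_prod_eq_prod_lintegral_of_indepFun Finset.univ
    (fun i (y : Fin n → ℝ) => d i (y i))
    (iIndepFun_pi fun i => (hdm i).aemeasurable) (fun i => (hdm i).comp (measurable_pi_apply i))]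
  refine Finset.prod_congr rfl fun i _ => ?_
  have h2 := (measurePreserving_eval (fun _ : Fin n => gaussianReal 0 s.toNNReal) i).lintegral_comp
    (hdm i)
  simp only [Function.eval] at h2
  rw [h2, hd]
  rw [lintegral_indicator (hB i), gaussianReal_of_var_ne_zero _ hs',
    gaussianReal_of_var_ne_zero _ hN', withDensity_apply _ (hB i), setLIntegral_withDensity_eq_setLIntegral_mul _
      (measurable_gaussianPDF _ _) (by fun_prop) (hB i)]
  refine lintegral_congr fun y => ?_
  exact gaussianPDF_mul_exp hs hN (u i) y

/-- Change of measure, in integral form. -/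
lemma lintegral_noise_const_add {n : ℕ} {s N : ℝ} (hs : 0 < s) (hN : 0 < N) (u : Fin n → ℝ)
    {f : (Fin n → ℝ) → ℝ≥0∞} (hf : Measurable f) :
    ∫⁻ z, f (u + z) ∂noise n N =
      ∫⁻ y, ENNReal.ofReal (Real.exp (infoDensity s N u y)) * f y ∂noise n s := by
  rw [← lintegral_map hf (by fun_prop : Measurable fun z => u + z), noise_map_const_add hs hN,
    lintegral_withDensity_eq_lintegral_mul _ (by fun_prop) hf]
  rfl

/-- A codeword `u` unrelated to the output `Y` of power `s` has information density above `γ` with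
probability at most `exp (-γ)`: the density `exp (infoDensity s N u ·)` has mean one. -/
lemma noise_lt_infoDensity_le {n : ℕ} {s N : ℝ} (hs : 0 < s) (hN : 0 < N) (u : Fin n → ℝ) (γ : ℝ) :
    noise n s {y | γ < infoDensity s N u y} ≤ ENNReal.ofReal (Real.exp (-γ)) := by
  have h1 := lintegral_noise_const_add hs hN u (f := fun _ => 1) measurable_const
  simp only [mul_one, lintegral_const, measure_univ] at h1
  have h2 := mul_meas_ge_le_lintegral (μ := noise n s)
    (by fun_prop : Measurable fun y => ENNReal.ofReal (Real.exp (infoDensity s N u y)))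
    (ENNReal.ofReal (Real.exp γ))
  rw [← h1] at h2
  rw [Real.exp_neg, ENNReal.ofReal_inv_of_pos (Real.exp_pos _)]
  rw [ENNReal.le_inv_iff_mul_le, mul_comm]
  refine le_trans ?_ h2
  gcongr with y
  exact fun hy => ENNReal.ofReal_le_ofReal (Real.exp_le_exp.2 hy.le)

/-! ### Concentration of the squared norm -/

lemma integral_sq_gaussianReal {v : ℝ} (hv : 0 ≤ v) :
    ∫ x, x ^ 2 ∂gaussianReal 0 v.toNNReal = v := by
  have h := variance_fun_id_gaussianReal (μ := 0) (v := v.toNNReal)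
  rw [variance_of_integral_eq_zero (by fun_prop) (by simp)] at h
  rw [h, Real.coe_toNNReal _ hv]

lemma memLp_sq_gaussianReal (v : NNReal) : MemLp (fun x : ℝ => x ^ 2) 2 (gaussianReal 0 v) := by
  have h := (memLp_id_gaussianReal' (μ := 0) (v := v) 4 (by norm_num))
  refine (memLp_two_iff_integrable_sq (by fun_prop)).2 ?_
  have := h.integrable_norm_pow (by norm_num)
  refine this.congr (Eventually.of_forall fun x => ?_)
  simp only [id, Real.norm_eq_abs, ← pow_mul]
  exact Even.pow_abs (by decide) x

lemma memLp_normSq {n : ℕ} {v : ℝ} : MemLp (normSq : (Fin n → ℝ) → ℝ) 2 (noise n v) := by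
  have : (normSq : (Fin n → ℝ) → ℝ) = fun x => ∑ i, (fun t : ℝ => t ^ 2) (x i) := rfl
  rw [this]
  refine memLp_finsetSum _ fun i _ => ?_
  exact (memLp_sq_gaussianReal _).comp_measurePreserving
    (measurePreserving_eval (fun _ : Fin n => gaussianReal 0 v.toNNReal) i)

lemma integrable_normSq {n : ℕ} {v : ℝ} : Integrable (normSq : (Fin n → ℝ) → ℝ) (noise n v) :=
  memLp_normSq.integrable (by norm_num)

lemma integrable_eval_noise {n : ℕ} {v : ℝ} (i : Fin n) :
    Integrable (fun z : Fin n → ℝ => z i) (noise n v) :=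
  integrable_comp_eval (μ := fun _ : Fin n => gaussianReal 0 v.toNNReal) (f := fun t : ℝ => t)
    ((memLp_id_gaussianReal' 1 (by norm_num)).integrable le_rfl)

lemma integral_eval_noise {n : ℕ} {v : ℝ} (i : Fin n) : ∫ z, z i ∂noise n v = 0 := by
  have := integral_comp_eval (μ := fun _ : Fin n => gaussianReal 0 v.toNNReal) (i := i)
    (f := fun t : ℝ => t) (by fun_prop)
  unfold noise
  rw [this, integral_id_gaussianReal]

lemma integral_normSq {n : ℕ} {v : ℝ} (hv : 0 ≤ v) : ∫ z, normSq z ∂noise n v = n * v := by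
  unfold normSq
  have hi : ∀ i : Fin n, ∫ z, z i ^ 2 ∂noise n v = v := fun i => by
    have := integral_comp_eval (μ := fun _ : Fin n => gaussianReal 0 v.toNNReal) (i := i)
      (f := fun t : ℝ => t ^ 2) (by fun_prop)
    unfold noise
    rw [this, integral_sq_gaussianReal hv]
  rw [integral_finsetSum]
  · simp [hi]
  · intro i _
    exact integrable_comp_eval (μ := fun _ : Fin n => gaussianReal 0 v.toNNReal)
      (f := fun t : ℝ => t ^ 2)
      ((memLp_sq_gaussianReal _).integrable (by norm_num))

/-- The weak law of large numbers for the power of white noise. -/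
lemma tendsto_noise_normSq {v δ : ℝ} (hv : 0 ≤ v) (hδ : 0 < δ) :
    Tendsto (fun n : ℕ => noise n v {z | n * δ ≤ |normSq z - n * v|}) atTop (𝓝 0) := by
  set K := Var[fun x : ℝ => x ^ 2; gaussianReal 0 v.toNNReal]
  have hb : ∀ n : ℕ, 1 ≤ n → noise n v {z | n * δ ≤ |normSq z - n * v|} ≤
      ENNReal.ofReal (K / δ ^ 2 * (n : ℝ)⁻¹) := by
    intro n hn
    have hn' : (0 : ℝ) < n := by exact_mod_cast hn
    have h := meas_ge_le_variance_div_sq (memLp_normSq (n := n) (v := v))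
      (c := n * δ) (by positivity)
    rw [integral_normSq hv] at h
    refine h.trans (le_of_eq ?_)
    congr 1
    have hvar : Var[normSq; noise n v] = n * K := by
      have := variance_sum_pi (μ := fun _ : Fin n => gaussianReal 0 v.toNNReal)
        (X := fun _ (x : ℝ) => x ^ 2) (fun _ => memLp_sq_gaussianReal _)
      have h2 : (normSq : (Fin n → ℝ) → ℝ) = ∑ i, fun ω : Fin n → ℝ => (ω i) ^ 2 := by
        ext x; simp [normSq]
      unfold noise
      rw [h2, this]
      simp [K]
    rw [hvar]
    field_simp
  have hlim : Tendsto (fun n : ℕ => ENNReal.ofReal (K / δ ^ 2 * (n : ℝ)⁻¹)) atTop (𝓝 0) := by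
    have := ENNReal.tendsto_ofReal ((tendsto_inv_atTop_nhds_zero_nat (𝕜 := ℝ)).const_mul (K / δ ^ 2))
    simpa using this
  refine tendsto_of_tendsto_of_tendsto_of_le_of_le' tendsto_const_nhds hlim
    (Eventually.of_forall fun _ => zero_le) ?_
  filter_upwards [eventually_ge_atTop 1] with n hn using hb n hn

/-! ### A Fano-type inequality -/

lemma normSq_add {n : ℕ} (v z : Fin n → ℝ) :
    normSq (v + z) = normSq v + 2 * ∑ i, v i * z i + normSq z := by
  unfold normSq
  rw [Finset.mul_sum, ← Finset.sum_add_distrib, ← Finset.sum_add_distrib]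
  exact Finset.sum_congr rfl fun i _ => by simp only [Pi.add_apply]; ring

lemma infoDensity_const_add {n : ℕ} (s N : ℝ) (v z : Fin n → ℝ) :
    infoDensity s N v (v + z) =
      (normSq v + 2 * ∑ i, v i * z i + normSq z) / (2 * s) - normSq z / (2 * N) +
        n * (1 / 2 * Real.log (s / N)) := by
  rw [infoDensity, normSq_add, add_sub_cancel_left]

lemma integrable_infoDensity {n : ℕ} (s N : ℝ) (v : Fin n → ℝ) :
    Integrable (fun z => infoDensity s N v (v + z)) (noise n N) := by
  simp_rw [infoDensity_const_add]
  have h := integrable_normSq (n := n) (v := N)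
  have h2 : Integrable (fun z : Fin n → ℝ => ∑ i, v i * z i) (noise n N) :=
    integrable_finsetSum _ fun i _ => (integrable_eval_noise i).const_mul _
  exact ((((integrable_const _).add (h2.const_mul 2)).add h).div_const _ |>.sub
    (h.div_const _)).add (integrable_const _)

/-- The relative entropy of `v + Z`, for `Z` of power `N`, with respect to white noise of
power `s`. -/
lemma integral_infoDensity {n : ℕ} {s N : ℝ} (hN : 0 < N) (v : Fin n → ℝ) :
    ∫ z, infoDensity s N v (v + z) ∂noise n N =
      (normSq v + n * N) / (2 * s) - n / 2 + n * (1 / 2 * Real.log (s / N)) := by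
  simp_rw [infoDensity_const_add]
  have h := integrable_normSq (n := n) (v := N)
  have h2 : Integrable (fun z : Fin n → ℝ => ∑ i, v i * z i) (noise n N) :=
    integrable_finsetSum _ fun i _ => (integrable_eval_noise i).const_mul _
  have h3 : ∫ z, ∑ i, v i * z i ∂noise n N = 0 := by
    rw [integral_finsetSum _ fun i _ => (integrable_eval_noise i).const_mul _]
    simp [integral_const_mul, integral_eval_noise]
  have e1 : Integrable (fun z : Fin n → ℝ => normSq v + 2 * ∑ i, v i * z i) (noise n N) :=
    (integrable_const _).add (h2.const_mul 2)
  have e2 : Integrable (fun z : Fin n → ℝ => normSq v + 2 * ∑ i, v i * z i + normSq z)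
    (noise n N) := e1.add h
  have e3 : Integrable (fun z : Fin n → ℝ => (normSq v + 2 * ∑ i, v i * z i + normSq z) / (2 * s) -
      normSq z / (2 * N)) (noise n N) := (e2.div_const _).sub (h.div_const _)
  rw [integral_add e3 (integrable_const _),
    integral_sub (e2.div_const _) (h.div_const _), integral_div, integral_div,
    integral_add e1 h, integral_add (integrable_const _) (h2.const_mul 2), integral_const_mul, h3,
    integral_normSq hN.le]
  simp only [integral_const, probReal_univ, smul_eq_mul]
  field_simp
  ring

/-- A variational lower bound on relative entropy, for the test function `t · 1_D`; it comes from
`x + 1 ≤ exp x` applied to `x = t · 1_D - infoDensity - log 2`. -/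
lemma noise_real_mul_le {n : ℕ} {s N : ℝ} (hs : 0 < s) (hN : 0 < N) (v : Fin n → ℝ)
    {D : Set (Fin n → ℝ)} (hD : MeasurableSet D) (t : ℝ) :
    (noise n N).real {z | v + z ∈ D} * t ≤
      (normSq v + n * N) / (2 * s) - n / 2 + n * (1 / 2 * Real.log (s / N)) + Real.log 2 - 1 +
        1 / 2 * (1 + Real.exp t * (noise n s).real D) := by
  set h : (Fin n → ℝ) → ℝ := fun y => 1 + Real.exp t * D.indicator 1 y with hdef
  have hh0 : ∀ y, 0 ≤ h y := fun y => by
    have : (0 : ℝ) ≤ D.indicator 1 y := Set.indicator_nonneg (fun _ _ => zero_le_one) y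
    positivity
  have hind : Measurable (D.indicator (1 : (Fin n → ℝ) → ℝ)) := measurable_one.indicator hD
  have hhm : Measurable h := by fun_prop
  have hindint : Integrable (D.indicator (1 : (Fin n → ℝ) → ℝ)) (noise n s) :=
    (integrable_const (1 : ℝ)).indicator hD
  have hhint : Integrable h (noise n s) := (integrable_const _).add (hindint.const_mul _)
  have hhval : ∫ y, h y ∂noise n s = 1 + Real.exp t * (noise n s).real D := by
    rw [hdef, integral_add (integrable_const _) (hindint.const_mul _), integral_const_mul,
      integral_indicator_one hD]
    simp
  set g : (Fin n → ℝ) → ℝ := fun z => Real.exp (-infoDensity s N v (v + z)) * h (v + z) with hg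
  have hg0 : ∀ z, 0 ≤ g z := fun z => mul_nonneg (Real.exp_pos _).le (hh0 _)
  have hgm : Measurable g := by fun_prop
  have hlin : ∫⁻ z, ENNReal.ofReal (g z) ∂noise n N = ∫⁻ y, ENNReal.ofReal (h y) ∂noise n s := by
    rw [hg, lintegral_noise_const_add hs hN v
      (f := fun y => ENNReal.ofReal (Real.exp (-infoDensity s N v y) * h y)) (by fun_prop)]
    refine lintegral_congr fun y => ?_
    rw [← ENNReal.ofReal_mul (Real.exp_pos _).le, ← mul_assoc, ← Real.exp_add]
    simp
  have hgint : Integrable g (noise n N) := by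
    rw [← lintegral_ofReal_ne_top_iff_integrable hgm.aestronglyMeasurable
      (Eventually.of_forall hg0), hlin]
    exact (lintegral_ofReal_ne_top_iff_integrable hhm.aestronglyMeasurable
      (Eventually.of_forall hh0)).2 hhint
  have hgval : ∫ z, g z ∂noise n N = 1 + Real.exp t * (noise n s).real D := by
    rw [← hhval, integral_eq_lintegral_of_nonneg_ae (Eventually.of_forall hg0)
      hgm.aestronglyMeasurable, hlin, integral_eq_lintegral_of_nonneg_ae
      (Eventually.of_forall hh0) hhm.aestronglyMeasurable]
  have hD' : MeasurableSet {z : Fin n → ℝ | v + z ∈ D} :=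
    (by fun_prop : Measurable fun z : Fin n → ℝ => v + z) hD
  set i : (Fin n → ℝ) → ℝ := fun z => {z : Fin n → ℝ | v + z ∈ D}.indicator 1 z * t
  have hiint : Integrable i (noise n N) :=
    ((integrable_const (1 : ℝ)).indicator hD').mul_const t
  have hival : ∫ z, i z ∂noise n N = (noise n N).real {z | v + z ∈ D} * t := by
    rw [integral_mul_const, integral_indicator_one hD']
  have hfint := integrable_infoDensity s N v
  have hle : ∫ z, (i z - infoDensity s N v (v + z) - Real.log 2 + 1) ∂noise n N ≤
      ∫ z, 1 / 2 * g z ∂noise n N := by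
    refine integral_mono (((hiint.sub hfint).sub (integrable_const _)).add (integrable_const _))
      (hgint.const_mul _) fun z => ?_
    refine (Real.add_one_le_exp _).trans ?_
    rw [Real.exp_sub, Real.exp_log two_pos, sub_eq_add_neg, Real.exp_add]
    have : Real.exp (i z) ≤ h (v + z) := by
      by_cases hz : v + z ∈ D
      · simp [i, h, hz]
      · simp [i, h, hz]
    have h3 := mul_le_mul_of_nonneg_right this (Real.exp_pos (-infoDensity s N v (v + z))).le
    simp only [hg]
    linarith
  have e1 : Integrable (fun z => i z - infoDensity s N v (v + z)) (noise n N) := hiint.sub hfint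
  have e2 : Integrable (fun z => i z - infoDensity s N v (v + z) - Real.log 2) (noise n N) :=
    e1.sub (integrable_const _)
  rw [integral_add e2 (integrable_const _), integral_sub e1 (integrable_const _), integral_sub hiint hfint, hival,
    integral_infoDensity hN, integral_const_mul, hgval] at hle
  simp only [integral_const, probReal_univ, smul_eq_mul, one_mul] at hle
  linarith

/-- Fano's inequality for additive white Gaussian noise: the number of messages is bounded in terms
of the mean power of the codewords around an arbitrary centre `m` and of the average probability of
correct decoding. -/
lemma sum_correct_mul_log_card_le {n : ℕ} {s N : ℝ} (hs : 0 < s) (hN : 0 < N) {W : Type*}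
    [Fintype W] [Nonempty W] (x : W → Fin n → ℝ) (m : Fin n → ℝ) (d : (Fin n → ℝ) → W)
    (hd : ∀ w, MeasurableSet (d ⁻¹' {w}))
    (hx : ∑ w, normSq (x w - m) ≤ Fintype.card W * (n * (s - N))) :
    (∑ w, (noise n N).real {z | d (x w + z) = w}) * Real.log (Fintype.card W) ≤
      Fintype.card W * (n * (1 / 2 * Real.log (s / N)) + Real.log 2) := by
  classical
  have hM : (0 : ℝ) < Fintype.card W := by exact_mod_cast Fintype.card_pos
  set D : W → Set (Fin n → ℝ) := fun w => (fun y => m + y) ⁻¹' (d ⁻¹' {w}) with hDdef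
  have hD : ∀ w, MeasurableSet (D w) := fun w => (by fun_prop : Measurable fun y => m + y) (hd w)
  have hone : ∑ w, (noise n s).real (D w) = 1 := by
    rw [← measureReal_biUnion_finset (fun w _ w' _ hww' => ?_) (fun w _ => hD w)]
    · have : ⋃ w ∈ Finset.univ, D w = Set.univ := by
        ext y; simp [hDdef]
      rw [this, probReal_univ]
    · refine Set.disjoint_left.2 fun y hy hy' => hww' ?_
      exact (Set.mem_singleton_iff.1 hy).symm.trans (Set.mem_singleton_iff.1 hy')
  have hstep : ∀ w, (noise n N).real {z | d (x w + z) = w} * Real.log (Fintype.card W) ≤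
      (normSq (x w - m) + n * N) / (2 * s) - n / 2 + n * (1 / 2 * Real.log (s / N)) +
        Real.log 2 - 1 + 1 / 2 * (1 + Fintype.card W * (noise n s).real (D w)) := by
    intro w
    have h := noise_real_mul_le hs hN (x w - m) (hD w) (Real.log (Fintype.card W))
    rw [Real.exp_log hM] at h
    have he : {z : Fin n → ℝ | x w - m + z ∈ D w} = {z | d (x w + z) = w} := by
      ext z
      have : m + (x w - m + z) = x w + z := by abel
      simp [hDdef, this]
    rwa [he] at h
  rw [Finset.sum_mul]
  refine (Finset.sum_le_sum fun w _ => hstep w).trans ?_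
  have hsum : ∑ w, ((normSq (x w - m) + n * N) / (2 * s) - n / 2 +
      n * (1 / 2 * Real.log (s / N)) + Real.log 2 - 1 +
        1 / 2 * (1 + Fintype.card W * (noise n s).real (D w))) =
      (∑ w, normSq (x w - m)) / (2 * s) + Fintype.card W * (n * N / (2 * s) - n / 2 +
        n * (1 / 2 * Real.log (s / N)) + Real.log 2) := by
    simp only [Finset.sum_add_distrib, Finset.sum_sub_distrib, ← Finset.mul_sum, ← Finset.sum_div,
      hone, Finset.sum_const, Finset.card_univ, nsmul_eq_mul]
    ring
  rw [hsum]
  have h1 : (∑ w, normSq (x w - m)) / (2 * s) ≤ Fintype.card W * (n * (s - N)) / (2 * s) := by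
    gcongr
  have h2 : (Fintype.card W : ℝ) * (n * (s - N)) / (2 * s) +
      Fintype.card W * (n * N / (2 * s) - n / 2) = 0 := by
    field_simp; ring
  linarith

/-! ### Error probabilities of a code -/

lemma uniformOn_univ_fin (M : ℕ) :
    (uniformOn (Set.univ : Set (Fin M))) = (M : ℝ≥0∞)⁻¹ • Measure.count := by
  simp [uniformOn, ProbabilityTheory.cond]

namespace Code

variable {n : ℕ} {P₁ P₂ : ℝ} (c : Code n P₁ P₂)

instance : NeZero c.M₁ := ⟨c.M₁_pos.ne'⟩
instance : NeZero c.M₂ := ⟨c.M₂_pos.ne'⟩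

lemma law_apply (N : ℝ) {A : Set (Fin c.M₁ × Fin c.M₂ × (Fin n → ℝ))} (hA : MeasurableSet A) :
    c.law N A = (c.M₁ : ℝ≥0∞)⁻¹ * ∑ w₁, (c.M₂ : ℝ≥0∞)⁻¹ * ∑ w₂,
      noise n N {z | (w₁, w₂, z) ∈ A} := by
  rw [law, Measure.prod_apply hA, uniformOn_univ_fin, lintegral_smul_measure, lintegral_count,
    tsum_fintype, smul_eq_mul]
  congr 1
  refine Finset.sum_congr rfl fun w₁ _ => ?_
  rw [Measure.prod_apply (measurable_prodMk_left hA), uniformOn_univ_fin, lintegral_smul_measure,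
    lintegral_count, tsum_fintype, smul_eq_mul]
  rfl

lemma measurableSet_dec₁_ne (w : Fin c.M₁) : MeasurableSet {y | c.dec₁ y ≠ w} :=
  c.measurable_dec₁ (MeasurableSet.singleton w).compl

lemma measurableSet_error₁ : MeasurableSet
    {ω : Fin c.M₁ × Fin c.M₂ × (Fin n → ℝ) | c.dec₁ (c.Y₁ ω) ≠ ω.1} := by
  have hY : Measurable c.Y₁ := by
    have : Measurable c.enc₁ := measurable_of_finite _
    unfold Y₁
    exact (this.comp measurable_fst).add (measurable_snd.comp measurable_snd)
  exact (measurableSet_eq_fun (c.measurable_dec₁.comp hY) measurable_fst).compl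

lemma measurableSet_error₂ (a : ℝ) : MeasurableSet
    {ω : Fin c.M₁ × Fin c.M₂ × (Fin n → ℝ) | c.dec₂ (c.Y₂ a ω) ≠ ω.2.1} := by
  have hY : Measurable (c.Y₂ a) := by
    have h₁ : Measurable c.enc₁ := measurable_of_finite _
    have h₂ : Measurable c.enc₂ := measurable_of_finite _
    unfold Y₂
    have h₁' : Measurable fun ω : Fin c.M₁ × Fin c.M₂ × (Fin n → ℝ) => c.enc₁ ω.1 :=
      h₁.comp measurable_fst
    have h₂' : Measurable fun ω : Fin c.M₁ × Fin c.M₂ × (Fin n → ℝ) => c.enc₂ ω.2.1 :=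
      h₂.comp (measurable_fst.comp measurable_snd)
    fun_prop
  exact (measurableSet_eq_fun (c.measurable_dec₂.comp hY)
    (measurable_fst.comp measurable_snd)).compl

lemma law_error₁ (N : ℝ) : c.law N {ω | c.dec₁ (c.Y₁ ω) ≠ ω.1} =
    (c.M₁ : ℝ≥0∞)⁻¹ * ∑ w₁, noise n N {z | c.dec₁ (c.enc₁ w₁ + z) ≠ w₁} := by
  rw [law_apply c N c.measurableSet_error₁]
  congr 1
  refine Finset.sum_congr rfl fun w₁ _ => ?_
  simp only [Set.mem_ofPred_eq, Y₁, Finset.sum_const, Finset.card_univ, Fintype.card_fin,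
    nsmul_eq_mul]
  rw [← mul_assoc, ENNReal.inv_mul_cancel (by simp [c.M₂_pos.ne']) (by simp), one_mul]

lemma law_error₂ (N a : ℝ) : c.law N {ω | c.dec₂ (c.Y₂ a ω) ≠ ω.2.1} =
    (c.M₁ : ℝ≥0∞)⁻¹ * ∑ w₁, (c.M₂ : ℝ≥0∞)⁻¹ * ∑ w₂,
      noise n N {z | c.dec₂ (c.enc₂ w₂ + √a • c.enc₁ w₁ + z) ≠ w₂} := by
  rw [law_apply c N (c.measurableSet_error₂ a)]
  rfl

lemma error₁_eq (N : ℝ) : c.M₁ * c.error₁ N =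
    ∑ w₁, (noise n N).real {z | c.dec₁ (c.enc₁ w₁ + z) ≠ w₁} := by
  have hM : (c.M₁ : ℝ) ≠ 0 := by exact_mod_cast c.M₁_pos.ne'
  rw [error₁, Measure.real, law_error₁, ENNReal.toReal_mul,
    ENNReal.toReal_sum (fun _ _ => measure_ne_top _ _)]
  simp only [ENNReal.toReal_inv, ENNReal.toReal_natCast, Measure.real]
  field_simp

lemma error₂_eq (N a : ℝ) : c.M₁ * c.M₂ * c.error₂ N a =
    ∑ w₁, ∑ w₂, (noise n N).real {z | c.dec₂ (c.enc₂ w₂ + √a • c.enc₁ w₁ + z) ≠ w₂} := by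
  have hM : (c.M₁ : ℝ) ≠ 0 := by exact_mod_cast c.M₁_pos.ne'
  have hM' : (c.M₂ : ℝ) ≠ 0 := by exact_mod_cast c.M₂_pos.ne'
  rw [error₂, Measure.real, law_error₂, ← Finset.mul_sum, ENNReal.toReal_mul, ENNReal.toReal_mul,
    ENNReal.toReal_sum (fun _ _ => ENNReal.sum_ne_top.2 fun _ _ => measure_ne_top _ _)]
  simp_rw [ENNReal.toReal_sum (fun _ _ => measure_ne_top _ _)]
  simp only [ENNReal.toReal_inv, ENNReal.toReal_natCast, Measure.real]
  field_simp

end Code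

/-! ### The sum-rate converse -/

/-- Centring a finite family of vectors at its mean: the deviations sum to zero and have no more
total power than the vectors. -/
lemma exists_sum_sub_eq_zero {n : ℕ} {W : Type*} [Fintype W] [Nonempty W] (x : W → Fin n → ℝ) :
    ∃ m : Fin n → ℝ, (∀ i, ∑ w, (x w i - m i) = 0) ∧
      ∑ w, normSq (x w - m) ≤ ∑ w, normSq (x w) := by
  have hM : (Fintype.card W : ℝ) ≠ 0 := by exact_mod_cast Fintype.card_ne_zero
  set m : Fin n → ℝ := fun i => (∑ w, x w i) / Fintype.card W with hm
  have h0 : ∀ i, ∑ w, (x w i - m i) = 0 := fun i => by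
    rw [Finset.sum_sub_distrib, Finset.sum_const, Finset.card_univ, nsmul_eq_mul, hm]
    field_simp
    ring
  refine ⟨m, h0, ?_⟩
  simp only [normSq, Pi.sub_apply]
  rw [Finset.sum_comm, Finset.sum_comm (f := fun w i => x w i ^ 2)]
  refine Finset.sum_le_sum fun i _ => ?_
  have h1 : ∑ w, x w i ^ 2 = ∑ w, ((x w i - m i) ^ 2 + 2 * m i * (x w i - m i) + m i ^ 2) :=
    Finset.sum_congr rfl fun w _ => by ring
  rw [h1, Finset.sum_add_distrib, Finset.sum_add_distrib, ← Finset.mul_sum, h0]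
  have : 0 ≤ ∑ _w : W, m i ^ 2 := Finset.sum_nonneg fun _ _ => sq_nonneg _
  linarith

namespace Code

variable {n : ℕ} {P₁ P₂ : ℝ} (c : Code n P₁ P₂)

/-- Signals of independent users have additive power once one of them is centred. -/
lemma exists_sum_normSq_le {a : ℝ} (ha : 0 ≤ a) : ∃ m : Fin n → ℝ,
    ∑ w : Fin c.M₁ × Fin c.M₂, normSq (c.enc₂ w.2 + √a • c.enc₁ w.1 - m) ≤
      c.M₁ * c.M₂ * (n * (a * P₁ + P₂)) := by
  obtain ⟨m, h0, hle⟩ := exists_sum_sub_eq_zero c.enc₁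
  refine ⟨√a • m, ?_⟩
  have hexp : ∀ w : Fin c.M₁ × Fin c.M₂, normSq (c.enc₂ w.2 + √a • c.enc₁ w.1 - √a • m) =
      normSq (c.enc₂ w.2) + ∑ i, 2 * √a * c.enc₂ w.2 i * (c.enc₁ w.1 i - m i) +
        a * normSq (c.enc₁ w.1 - m) := by
    intro w
    unfold normSq
    rw [Finset.mul_sum, ← Finset.sum_add_distrib, ← Finset.sum_add_distrib]
    refine Finset.sum_congr rfl fun i _ => ?_
    simp only [Pi.add_apply, Pi.sub_apply, Pi.smul_apply, smul_eq_mul]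
    linear_combination (c.enc₁ w.1 i - m i) ^ 2 * Real.sq_sqrt ha
  simp_rw [hexp]
  rw [Finset.sum_add_distrib, Finset.sum_add_distrib, Fintype.sum_prod_type,
    Fintype.sum_prod_type_right, Fintype.sum_prod_type]
  have hcross : ∑ w₂ : Fin c.M₂, ∑ w₁ : Fin c.M₁,
      ∑ i, 2 * √a * c.enc₂ w₂ i * (c.enc₁ w₁ i - m i) = 0 := by
    refine Finset.sum_eq_zero fun w₂ _ => ?_
    rw [Finset.sum_comm]
    refine Finset.sum_eq_zero fun i _ => ?_
    rw [← Finset.mul_sum, h0, mul_zero]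
  have h1 : ∑ w₁, normSq (c.enc₁ w₁) ≤ c.M₁ * (n * P₁) := by
    refine (Finset.sum_le_sum fun w _ => c.power₁ w).trans (le_of_eq ?_)
    simp
  have h2 : ∑ w₂, normSq (c.enc₂ w₂) ≤ c.M₂ * (n * P₂) := by
    refine (Finset.sum_le_sum fun w _ => c.power₂ w).trans (le_of_eq ?_)
    simp
  simp only [hcross, Finset.sum_const, Finset.card_univ, Fintype.card_fin, nsmul_eq_mul,
    ← Finset.mul_sum]
  have h3 := mul_le_mul_of_nonneg_left h2 (Nat.cast_nonneg (α := ℝ) c.M₁)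
  have h4 := mul_le_mul_of_nonneg_left (mul_le_mul_of_nonneg_left (hle.trans h1) ha)
    (Nat.cast_nonneg (α := ℝ) c.M₂)
  linarith

end Code

/-- White noise of power `N` is the sum of its copy attenuated by `√a ≥ 1` and independent noise. -/
lemma noise_prod_map_inv_smul_add (n : ℕ) {N a : ℝ} (hN : 0 ≤ N) (ha : 1 ≤ a) :
    ((noise n (N * (1 - a⁻¹))).prod (noise n N)).map (fun p => (√a)⁻¹ • p.2 + p.1) =
      noise n N := by
  have ha0 : 0 < a := by linarith
  have hinv : a⁻¹ ≤ 1 := inv_le_one_of_one_le₀ ha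
  have h := noise_prod_map_add n (Q := N * (1 - a⁻¹)) (N := a⁻¹ * N)
    (mul_nonneg hN (by linarith)) (by positivity)
  have h2 : noise n (a⁻¹ * N) = (noise n N).map (fun x => (√a)⁻¹ • x) := by
    rw [noise_map_smul, inv_pow, Real.sq_sqrt ha0.le]
  have hm := Measure.map_prod_map (noise n (N * (1 - a⁻¹))) (noise n N)
    (f := id) (g := fun x => (√a)⁻¹ • x) measurable_id (by fun_prop)
  rw [Measure.map_id] at hm
  rw [h2, hm, Measure.map_map (by fun_prop) (by fun_prop)] at h
  have h3 : N * (1 - a⁻¹) + a⁻¹ * N = N := by ring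
  rw [h3] at h
  refine Eq.trans ?_ h
  congr 1
  ext p : 1
  simp [add_comm]

namespace Code

variable {n : ℕ} {P₁ P₂ : ℝ} (c : Code n P₁ P₂)

/-- The first decoder still works on the less noisy observation `X₁ + Z / √a`, after a suitable
deterministic shift: a random shift restores the noise of the first receiver, so some value of the
shift does at least as well. -/
lemma exists_shift {N a : ℝ} (hN : 0 ≤ N) (ha : 1 ≤ a) : ∃ v : Fin n → ℝ,
    ∑ w₁, (noise n N).real {z | c.dec₁ (c.enc₁ w₁ + ((√a)⁻¹ • z + v)) ≠ w₁} ≤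
      c.M₁ * c.error₁ N := by
  set B : Fin c.M₁ → Set ((Fin n → ℝ) × (Fin n → ℝ)) := fun w₁ =>
    {p | c.dec₁ (c.enc₁ w₁ + ((√a)⁻¹ • p.2 + p.1)) ≠ w₁} with hBdef
  have hB : ∀ w₁, MeasurableSet (B w₁) := fun w₁ =>
    (by fun_prop : Measurable fun p : (Fin n → ℝ) × (Fin n → ℝ) =>
      c.enc₁ w₁ + ((√a)⁻¹ • p.2 + p.1)) (c.measurableSet_dec₁_ne w₁)
  have hmeas : ∀ w₁, Measurable fun v => noise n N (Prod.mk v ⁻¹' B w₁) := fun w₁ =>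
    measurable_measure_prodMk_left (hB w₁)
  obtain ⟨v, hv⟩ := exists_le_lintegral (μ := noise n (N * (1 - a⁻¹)))
    (f := fun v => ∑ w₁, noise n N (Prod.mk v ⁻¹' B w₁))
    (Finset.univ.measurable_fun_sum fun w₁ _ => hmeas w₁).aemeasurable
  refine ⟨v, ?_⟩
  have hval : ∀ w₁, ∫⁻ v, noise n N (Prod.mk v ⁻¹' B w₁) ∂noise n (N * (1 - a⁻¹)) =
      noise n N {z | c.dec₁ (c.enc₁ w₁ + z) ≠ w₁} := by
    intro w₁
    rw [← Measure.prod_apply (hB w₁)]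
    refine Eq.trans ?_ (congrArg (fun μ : Measure (Fin n → ℝ) =>
      μ {z | c.dec₁ (c.enc₁ w₁ + z) ≠ w₁}) (noise_prod_map_inv_smul_add n hN ha))
    rw [Measure.map_apply (by fun_prop)]
    · rfl
    · exact (by fun_prop : Measurable fun z : Fin n → ℝ => c.enc₁ w₁ + z)
        (c.measurableSet_dec₁_ne w₁)
  rw [lintegral_finsetSum _ fun w₁ _ => hmeas w₁] at hv
  simp_rw [hval] at hv
  rw [error₁_eq]
  simp only [Measure.real]
  rw [← ENNReal.toReal_sum (fun _ _ => measure_ne_top _ _),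
    ← ENNReal.toReal_sum (fun _ _ => measure_ne_top _ _)]
  exact ENNReal.toReal_mono (ENNReal.sum_ne_top.2 fun _ _ => measure_ne_top _ _) hv

/-- In the strong interference regime `a ≥ 1` the second receiver can decode both messages: having
decoded `W₂`, it subtracts `X₂` and is left with a better observation of `X₁` than the first
receiver. Hence the sum rate obeys the bound of the multiple-access channel. -/
lemma sum_rate_le {N a : ℝ} (hP₁ : 0 ≤ P₁) (hP₂ : 0 ≤ P₂) (hN : 0 < N) (ha : 1 ≤ a) :
    (1 - c.error₁ N - c.error₂ N a) * (Real.log c.M₁ + Real.log c.M₂) ≤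
      n * (1 / 2 * Real.log (1 + (a * P₁ + P₂) / N)) + Real.log 2 := by
  have ha0 : 0 < a := by linarith
  have hM₁ : (0 : ℝ) < c.M₁ := by exact_mod_cast c.M₁_pos
  have hM₂ : (0 : ℝ) < c.M₂ := by exact_mod_cast c.M₂_pos
  obtain ⟨v, hv⟩ := c.exists_shift hN.le ha
  obtain ⟨m, hm⟩ := c.exists_sum_normSq_le ha0.le
  set s := a * P₁ + P₂ + N with hs
  have hs0 : 0 < s := by positivity
  set x : Fin c.M₁ × Fin c.M₂ → Fin n → ℝ := fun w => c.enc₂ w.2 + √a • c.enc₁ w.1 with hx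
  set d : (Fin n → ℝ) → Fin c.M₁ × Fin c.M₂ := fun y =>
    (c.dec₁ ((√a)⁻¹ • (y - c.enc₂ (c.dec₂ y)) + v), c.dec₂ y) with hd
  have hdm : Measurable d := by
    have h₂ : Measurable c.enc₂ := measurable_of_finite _
    have h₂' : Measurable fun y => c.enc₂ (c.dec₂ y) := h₂.comp c.measurable_dec₂
    exact (c.measurable_dec₁.comp (by fun_prop)).prodMk c.measurable_dec₂
  have hF := sum_correct_mul_log_card_le hs0 hN x m d (fun w => hdm (measurableSet_singleton w)) (by
    refine hm.trans (le_of_eq ?_)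
    simp only [Fintype.card_prod, Fintype.card_fin, Nat.cast_mul, hs]
    ring)
  have hcorr : ∀ w : Fin c.M₁ × Fin c.M₂, 1 -
      (noise n N).real {z | c.dec₁ (c.enc₁ w.1 + ((√a)⁻¹ • z + v)) ≠ w.1} -
        (noise n N).real {z | c.dec₂ (c.enc₂ w.2 + √a • c.enc₁ w.1 + z) ≠ w.2} ≤
      (noise n N).real {z | d (x w + z) = w} := by
    intro w
    have hsub : (Set.univ : Set (Fin n → ℝ)) ⊆ {z | d (x w + z) = w} ∪
        ({z | c.dec₁ (c.enc₁ w.1 + ((√a)⁻¹ • z + v)) ≠ w.1} ∪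
          {z | c.dec₂ (c.enc₂ w.2 + √a • c.enc₁ w.1 + z) ≠ w.2}) := by
      intro z _
      by_contra hz
      simp only [Set.mem_union, Set.mem_ofPred_eq, not_or, ne_eq, not_not] at hz
      obtain ⟨hz0, hz1, hz2⟩ := hz
      refine hz0 (Prod.ext ?_ hz2)
      simp only [hd, hx, hz2]
      have hs' : √a ≠ 0 := (Real.sqrt_pos.2 ha0).ne'
      have : (√a)⁻¹ • (c.enc₂ w.2 + √a • c.enc₁ w.1 + z - c.enc₂ w.2) + v =
          c.enc₁ w.1 + ((√a)⁻¹ • z + v) := by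
        ext i
        simp only [Pi.add_apply, Pi.smul_apply, Pi.sub_apply, smul_eq_mul]
        field_simp
        ring
      rw [this, hz1]
    have h1 := measureReal_mono (μ := noise n N) hsub
    have h2 := measureReal_union_le (μ := noise n N) {z | d (x w + z) = w}
      ({z | c.dec₁ (c.enc₁ w.1 + ((√a)⁻¹ • z + v)) ≠ w.1} ∪
          {z | c.dec₂ (c.enc₂ w.2 + √a • c.enc₁ w.1 + z) ≠ w.2})
    have h3 := measureReal_union_le (μ := noise n N)
      {z | c.dec₁ (c.enc₁ w.1 + ((√a)⁻¹ • z + v)) ≠ w.1}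
          {z | c.dec₂ (c.enc₂ w.2 + √a • c.enc₁ w.1 + z) ≠ w.2}
    rw [probReal_univ] at h1
    linarith
  have hsum := Finset.sum_le_sum fun w (_ : w ∈ Finset.univ) => hcorr w
  rw [Finset.sum_sub_distrib, Finset.sum_sub_distrib, Fintype.sum_prod_type_right
    (f := fun w : Fin c.M₁ × Fin c.M₂ =>
      (noise n N).real {z | c.dec₁ (c.enc₁ w.1 + ((√a)⁻¹ • z + v)) ≠ w.1}),
    Fintype.sum_prod_type (f := fun w : Fin c.M₁ × Fin c.M₂ =>
      (noise n N).real {z | c.dec₂ (c.enc₂ w.2 + √a • c.enc₁ w.1 + z) ≠ w.2}),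
    ← error₂_eq] at hsum
  simp only [Finset.sum_const, Finset.card_univ, Fintype.card_prod, Fintype.card_fin,
    nsmul_eq_mul, Nat.cast_mul, mul_one] at hsum hF
  rw [Real.log_mul hM₁.ne' hM₂.ne'] at hF
  have hlog : 0 ≤ Real.log c.M₁ + Real.log c.M₂ :=
    add_nonneg (Real.log_natCast_nonneg _) (Real.log_natCast_nonneg _)
  have hsN : s / N = 1 + (a * P₁ + P₂) / N := by rw [hs]; field_simp; ring
  rw [hsN] at hF
  have hv' := mul_le_mul_of_nonneg_left hv hM₂.le
  have key : (c.M₁ * c.M₂ : ℝ) * (1 - c.error₁ N - c.error₂ N a) ≤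
      ∑ w, (noise n N).real {z | d (x w + z) = w} := by
    linarith
  have := (mul_le_mul_of_nonneg_right key hlog).trans hF
  rw [mul_assoc] at this
  exact le_of_mul_le_mul_left this (mul_pos hM₁ hM₂)

end Code

/-- The asymptotic sum-rate bound, with the rate of one user bounded below. -/
lemma almostLE_of_sum_rate {r₁ r₂ e : ℕ → ℝ} {S C : ℝ} (he : Tendsto e atTop (𝓝 0))
    (h : ∀ n : ℕ, 1 ≤ n → (1 - e n) * (r₁ n + r₂ n) ≤ S + Real.log 2 / n)
    (hC : AlmostLE (fun n => n * C) (fun n => n * r₁ n)) :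
    AlmostLE (fun n => n * r₂ n) (fun n => n * (S - C)) := by
  obtain ⟨ε, hε0, hε, hle⟩ := hC
  -- The bound `r₁ + r₂ ≤ (S + log 2 / n) / (1 - e n)` is available once `e n < 1`; for the other
  -- finitely many `n` the value of the error term is immaterial.
  set f : ℕ → ℝ := fun n => (S + Real.log 2 / n) / (1 - e n) - S + ε n with hf
  have hflim : Tendsto f atTop (𝓝 0) := by
    have h1 : Tendsto (fun n : ℕ => S + Real.log 2 / n) atTop (𝓝 (S + 0)) :=
      tendsto_const_nhds.add (tendsto_const_div_atTop_nhds_zero_nat _)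
    have h2 : Tendsto (fun n => 1 - e n) atTop (𝓝 (1 - 0)) := tendsto_const_nhds.sub he
    have h3 := ((h1.div h2 (by norm_num)).sub (tendsto_const_nhds (x := S))).add hε
    have h4 : (S + 0) / (1 - 0) - S + 0 = 0 := by simp
    rw [h4] at h3
    exact h3
  set δ : ℕ → ℝ := fun n => max (r₂ n - (S - C)) 0 + 1 / (n + 1) with hδ
  refine ⟨δ, fun n => by positivity, ?_, fun n hn => ?_⟩
  · have hsmall : ∀ᶠ n in atTop, max (r₂ n - (S - C)) 0 ≤ |f n| := by
      filter_upwards [he.eventually_lt_const one_pos, eventually_ge_atTop 1] with n hn1 hn2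
      refine max_le (le_trans ?_ (le_abs_self _)) (abs_nonneg _)
      have hn' : (0 : ℝ) < n := by exact_mod_cast hn2
      have h1 : r₁ n + r₂ n ≤ (S + Real.log 2 / n) / (1 - e n) := by
        rw [le_div_iff₀ (by linarith), mul_comm]
        exact h n hn2
      have h2 : C ≤ r₁ n + ε n := by
        have := hle n hn2
        simp only [← mul_add] at this
        exact le_of_mul_le_mul_left this hn'
      simp only [hf]
      linarith
    have h1 : Tendsto (fun n => max (r₂ n - (S - C)) 0) atTop (𝓝 0) :=
      tendsto_of_tendsto_of_tendsto_of_le_of_le' tendsto_const_nhds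
        (by simpa using hflim.abs) (Eventually.of_forall fun _ => le_max_right _ _) hsmall
    simpa [hδ] using h1.add (tendsto_one_div_add_atTop_nhds_zero_nat (𝕜 := ℝ))
  · simp only [← mul_add]
    refine mul_le_mul_of_nonneg_left ?_ (Nat.cast_nonneg n)
    have h1 := le_max_left (r₂ n - (S - C)) 0
    have h2 : (0 : ℝ) ≤ 1 / (n + 1) := by positivity
    simp only [hδ]
    linarith

namespace Reliable

variable {P₁ P₂ N a : ℝ} {c : (n : ℕ) → Code n P₁ P₂}

lemma sum_rate_le (hc : Reliable N a c) (hP₁ : 0 ≤ P₁) (hP₂ : 0 ≤ P₂) (hN : 0 < N) (ha : 1 ≤ a) :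
    Tendsto (fun n => (c n).error₁ N + (c n).error₂ N a) atTop (𝓝 0) ∧
    ∀ n : ℕ, 1 ≤ n → (1 - ((c n).error₁ N + (c n).error₂ N a)) * ((c n).R₁ + (c n).R₂) ≤
      1 / 2 * Real.log (1 + (a * P₁ + P₂) / N) + Real.log 2 / n := by
  refine ⟨by simpa using hc.1.add hc.2, fun n hn => ?_⟩
  have hn' : (0 : ℝ) < n := by exact_mod_cast hn
  have h := (c n).sum_rate_le hP₁ hP₂ hN ha
  have h2 := div_le_div_of_nonneg_right h hn'.le
  rw [add_div, mul_div_cancel_left₀ _ hn'.ne'] at h2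
  refine le_trans (le_of_eq ?_) h2
  rw [Code.R₁, Code.R₂]
  ring

lemma almostLE_R₂ (hc : Reliable N a c) (hP₁ : 0 ≤ P₁) (hP₂ : 0 ≤ P₂) (hN : 0 < N) (ha : 1 ≤ a)
    {C : ℝ} (h : AlmostLE (fun n => n * C) (fun n => n * (c n).R₁)) :
    AlmostLE (fun n => n * (c n).R₂)
      (fun n => n * (1 / 2 * Real.log (1 + (a * P₁ + P₂) / N) - C)) :=
  have hs := hc.sum_rate_le hP₁ hP₂ hN ha
  almostLE_of_sum_rate hs.1 hs.2 h

lemma almostLE_R₁ (hc : Reliable N a c) (hP₁ : 0 ≤ P₁) (hP₂ : 0 ≤ P₂) (hN : 0 < N) (ha : 1 ≤ a)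
    {C : ℝ} (h : AlmostLE (fun n => n * C) (fun n => n * (c n).R₂)) :
    AlmostLE (fun n => n * (c n).R₁)
      (fun n => n * (1 / 2 * Real.log (1 + (a * P₁ + P₂) / N) - C)) :=
  have hs := hc.sum_rate_le hP₁ hP₂ hN ha
  almostLE_of_sum_rate hs.1
    (fun n hn => by rw [add_comm (c n).R₂]; exact hs.2 n hn) h

end Reliable

/-! ### Random coding with threshold decoding -/

/-- The probability that the information density of the transmitted codeword, drawn from white
noise of power `Q`, does not exceed the threshold `γ`. -/
noncomputable def missProb (n : ℕ) (Q N γ : ℝ) : ℝ≥0∞ :=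
  ((noise n Q).prod (noise n N)) {p | ¬ γ < infoDensity (Q + N) N p.1 (p.1 + p.2)}

lemma tendsto_missProb {Q N η : ℝ} (hQ : 0 ≤ Q) (hN : 0 < N) (hη : 0 < η) :
    Tendsto (fun n : ℕ => missProb n Q N (n * (capacity Q N - η))) atTop (𝓝 0) := by
  set s := Q + N with hs
  have hs0 : 0 < s := by positivity
  have h1 := tendsto_noise_normSq hs0.le (mul_pos hs0 hη)
  have h2 := tendsto_noise_normSq hN.le (mul_pos hN hη)
  have h3 := h1.add h2
  rw [add_zero] at h3
  refine tendsto_of_tendsto_of_tendsto_of_le_of_le tendsto_const_nhds h3 (fun _ => zero_le)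
    fun n => ?_
  have hsub : {p : (Fin n → ℝ) × (Fin n → ℝ) |
      ¬ n * (capacity Q N - η) < infoDensity (Q + N) N p.1 (p.1 + p.2)} ⊆
      (fun p => p.1 + p.2) ⁻¹' {y | n * (s * η) ≤ |normSq y - n * s|} ∪
        Prod.snd ⁻¹' {z | n * (N * η) ≤ |normSq z - n * N|} := by
    intro p hp
    by_contra hc
    simp only [Set.mem_union, Set.mem_preimage, Set.mem_ofPred_eq, not_or, not_le] at hc
    obtain ⟨hy, hz⟩ := hc
    refine hp ?_
    rw [infoDensity, add_sub_cancel_left]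
    have hC : capacity Q N = 1 / 2 * Real.log ((Q + N) / N) := by
      rw [capacity]; congr 2; field_simp; ring
    rw [← hC, ← hs]
    have hy' := (abs_lt.1 hy).1
    have hz' := (abs_lt.1 hz).2
    have e1 : n * (1 - η) / 2 < normSq (p.1 + p.2) / (2 * s) := by
      rw [lt_div_iff₀ (by positivity)]; linarith
    have e2 : normSq p.2 / (2 * N) < n * (1 + η) / 2 := by
      rw [div_lt_iff₀ (by positivity)]; linarith
    linarith
  refine (measure_mono hsub).trans ((measure_union_le _ _).trans (le_of_eq ?_))
  congr 1
  · rw [hs, ← noise_prod_map_add n hQ hN.le, Measure.map_apply (by fun_prop)]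
    exact measurableSet_le (by fun_prop) ((measurable_normSq.sub_const _).abs)
  · have : MeasurableSet {z : Fin n → ℝ | n * (N * η) ≤ |normSq z - n * N|} :=
      measurableSet_le (by fun_prop) ((measurable_normSq.sub_const _).abs)
    exact measurePreserving_snd.measure_preimage this.nullMeasurableSet

/-- Union bound, averaged over the messages, for the error probability of threshold decoding of the
signals `x w` in noise of power `N`: the transmitted signal misses the threshold `γ`, or some
competing signal, one related by `R` to the transmitted one, passes it. -/
noncomputable def thresholdError {n : ℕ} {W : Type*} [Fintype W] (R : W → W → Prop)
    [DecidableRel R] (s N γ : ℝ) (x : W → Fin n → ℝ) : ℝ≥0∞ :=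
  (Fintype.card W : ℝ≥0∞)⁻¹ * ∑ w, (noise n N {z | ¬ γ < infoDensity s N (x w) (x w + z)} +
    ∑ w' with R w w', noise n N {z | γ < infoDensity s N (x w') (x w + z)})

lemma measurable_noise_lt_infoDensity {n : ℕ} {s N γ : ℝ} {α : Type*} [MeasurableSpace α]
    {u x : α → Fin n → ℝ} (hu : Measurable u) (hx : Measurable x) :
    Measurable fun b => noise n N {z | γ < infoDensity s N (u b) (x b + z)} := by
  have h : MeasurableSet {p : α × (Fin n → ℝ) | γ < infoDensity s N (u p.1) (x p.1 + p.2)} :=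
    measurableSet_lt measurable_const (by fun_prop)
  exact measurable_measure_prodMk_left h

lemma measurable_noise_not_lt_infoDensity {n : ℕ} {s N γ : ℝ} {α : Type*} [MeasurableSpace α]
    {u x : α → Fin n → ℝ} (hu : Measurable u) (hx : Measurable x) :
    Measurable fun b => noise n N {z | ¬ γ < infoDensity s N (u b) (x b + z)} := by
  have h : MeasurableSet {p : α × (Fin n → ℝ) | ¬ γ < infoDensity s N (u p.1) (x p.1 + p.2)} :=
    (measurableSet_lt measurable_const (measurable_infoDensity s N (hu.comp measurable_fst)
      ((hx.comp measurable_fst).add measurable_snd))).compl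
  exact measurable_measure_prodMk_left h

lemma measurable_thresholdError {n : ℕ} {W : Type*} [Fintype W] {R : W → W → Prop}
    [DecidableRel R] {s N γ : ℝ} {α : Type*} [MeasurableSpace α] {X : W → α → Fin n → ℝ}
    (hX : ∀ w, Measurable (X w)) :
    Measurable fun b => thresholdError R s N γ (fun w => X w b) := by
  unfold thresholdError
  refine Measurable.const_mul (Finset.univ.measurable_fun_sum fun w _ => ?_) _
  exact (measurable_noise_not_lt_infoDensity (hX w) (hX w)).add
    (Finset.measurable_fun_sum _ fun w' _ => measurable_noise_lt_infoDensity (hX w') (hX w))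

/-- The random coding bound. Signals are random, each with a law dominated by `K` times white noise
of power `Q`, and every competing signal is independent of the transmitted one. -/
lemma lintegral_thresholdError_le {n : ℕ} {W : Type*} [Fintype W] [Nonempty W] {R : W → W → Prop}
    [DecidableRel R] {Q N : ℝ} (hQ : 0 ≤ Q) (hN : 0 < N) (γ : ℝ) {α : Type*} [MeasurableSpace α]
    {ρ : Measure α} [IsProbabilityMeasure ρ] {X : W → α → Fin n → ℝ}
    (hX : ∀ w, Measurable (X w)) {K : ℝ≥0∞} (hlaw : ∀ w, ρ.map (X w) ≤ K • noise n Q)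
    (hind : ∀ w w', R w w' → IndepFun (X w') (X w) ρ) :
    ∫⁻ b, thresholdError R (Q + N) N γ (fun w => X w b) ∂ρ ≤
      K * missProb n Q N γ + Fintype.card W * (K * ENNReal.ofReal (Real.exp (-γ))) := by
  have hs : 0 < Q + N := by positivity
  have hmiss : ∀ w, ∫⁻ b, noise n N {z | ¬ γ < infoDensity (Q + N) N (X w b) (X w b + z)} ∂ρ ≤
      K * missProb n Q N γ := by
    intro w
    rw [← lintegral_map (f := fun x => noise n N {z | ¬ γ < infoDensity (Q + N) N x (x + z)})
      (measurable_noise_not_lt_infoDensity measurable_id measurable_id) (hX w)]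
    refine (lintegral_mono' (hlaw w) le_rfl).trans (le_of_eq ?_)
    rw [lintegral_smul_measure, missProb, Measure.prod_apply]
    · rfl
    · exact (measurableSet_lt measurable_const (measurable_infoDensity _ N measurable_fst
        (measurable_fst.add measurable_snd))).compl
  have hwrong : ∀ w w', R w w' →
      ∫⁻ b, noise n N {z | γ < infoDensity (Q + N) N (X w' b) (X w b + z)} ∂ρ ≤
        K * ENNReal.ofReal (Real.exp (-γ)) := by
    intro w w' hR
    have : IsProbabilityMeasure (ρ.map (X w')) :=
      Measure.isProbabilityMeasure_map (hX w').aemeasurable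
    have : IsProbabilityMeasure (ρ.map (X w)) :=
      Measure.isProbabilityMeasure_map (hX w).aemeasurable
    have hm : Measurable fun p : (Fin n → ℝ) × (Fin n → ℝ) =>
        noise n N {z | γ < infoDensity (Q + N) N p.1 (p.2 + z)} :=
      measurable_noise_lt_infoDensity measurable_fst measurable_snd
    have h1 := lintegral_map (μ := ρ) hm ((hX w').prodMk (hX w))
    rw [(indepFun_iff_map_prod_eq_prod_map_map (hX w').aemeasurable (hX w).aemeasurable).1
      (hind w w' hR)] at h1
    rw [← h1, lintegral_prod _ hm.aemeasurable]
    have hu : ∀ u, ∫⁻ x, noise n N {z | γ < infoDensity (Q + N) N u (x + z)} ∂ρ.map (X w) ≤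
        K * ENNReal.ofReal (Real.exp (-γ)) := by
      intro u
      refine (lintegral_mono' (hlaw w) le_rfl).trans ?_
      rw [lintegral_smul_measure, smul_eq_mul]
      refine mul_le_mul_right ?_ K
      have hA : MeasurableSet {y : Fin n → ℝ | γ < infoDensity (Q + N) N u y} :=
        measurableSet_lt measurable_const (by fun_prop)
      refine le_trans (le_of_eq ?_) (noise_lt_infoDensity_le hs hN u γ)
      rw [← noise_prod_map_add n hQ hN.le, Measure.map_apply (by fun_prop) hA,
        Measure.prod_apply ((by fun_prop : Measurable fun p : (Fin n → ℝ) × (Fin n → ℝ) =>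
          p.1 + p.2) hA)]
      rfl
    exact (lintegral_mono hu).trans (by simp)
  have hM0 : (Fintype.card W : ℝ≥0∞) ≠ 0 := by simp
  have hM : (Fintype.card W : ℝ≥0∞) ≠ ∞ := ENNReal.natCast_ne_top _
  unfold thresholdError
  rw [lintegral_const_mul' _ _ (ENNReal.inv_ne_top.2 hM0), ENNReal.inv_mul_le_iff hM0 hM,
    lintegral_finsetSum]
  · refine (Finset.sum_le_card_nsmul _ _ (K * missProb n Q N γ +
      Fintype.card W * (K * ENNReal.ofReal (Real.exp (-γ)))) fun w _ => ?_).trans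
        (by rw [Finset.card_univ, nsmul_eq_mul])
    rw [lintegral_add_left (measurable_noise_not_lt_infoDensity (hX w) (hX w)),
      lintegral_finsetSum _ fun w' _ => measurable_noise_lt_infoDensity (hX w') (hX w)]
    refine add_le_add (hmiss w) ((Finset.sum_le_card_nsmul _ _ _ fun w' hw' =>
      hwrong w w' (Finset.mem_filter.1 hw').2).trans ?_)
    rw [nsmul_eq_mul]
    gcongr
    exact Finset.card_le_univ _
  · exact fun w _ => (measurable_noise_not_lt_infoDensity (hX w) (hX w)).add
      (Finset.measurable_fun_sum _ fun w' _ => measurable_noise_lt_infoDensity (hX w') (hX w))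

/-- A decoder that picks an index whose acceptance region contains the output, and hence the right
one whenever only that one accepts. -/
lemma exists_decoder {Y W : Type*} [MeasurableSpace Y] [Fintype W] [Nonempty W]
    [MeasurableSpace W] {A : W → Set Y} (hA : ∀ w, MeasurableSet (A w)) :
    ∃ d : Y → W, Measurable d ∧ ∀ w y, y ∈ A w → (∀ w', w' ≠ w → y ∉ A w') → d y = w := by
  classical
  -- The decoder depends on the output only through the pattern of accepting indices.
  set p : Y → W → Prop := fun y w => y ∈ A w
  have hp : Measurable p := measurable_pi_lambda _ fun w => measurableSet_setOfPred.1 (hA w)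
  set g : (W → Prop) → W := fun q => if h : ∃ w, q w then h.choose else Classical.arbitrary W
  refine ⟨g ∘ p, (measurable_of_finite g).comp hp, fun w y hw hw' => ?_⟩
  have h : ∃ w, p y w := ⟨w, hw⟩
  have hg : g (p y) = h.choose := dif_pos h
  by_contra hne
  refine hw' _ ?_ h.choose_spec
  rwa [← hg]

/-- The code built from a codebook by threshold decoding. The second receiver looks for a pair of
messages passing two tests, the density of the sum signal against `γ` and, after subtracting the
signal of the first user, the density of the second codeword against `γ₂`. It only needs the second
message of the pair, so a competing pair either has the first message right, and then the second
test is the relevant one, or differs in both messages. -/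
lemma exists_code_of_codebook {n M₁ M₂ : ℕ} [NeZero M₁] [NeZero M₂] {P₁ P₂ : ℝ} (N a : ℝ)
    {x₁ : Fin M₁ → Fin n → ℝ} {x₂ : Fin M₂ → Fin n → ℝ} (h₁ : ∀ w, normSq (x₁ w) ≤ n * P₁)
    (h₂ : ∀ w, normSq (x₂ w) ≤ n * P₂) (s₁ s₂ s γ₁ γ₂ γ : ℝ) :
    ∃ c : Code n P₁ P₂, c.M₁ = M₁ ∧ c.M₂ = M₂ ∧
      c.law N {ω | c.dec₁ (c.Y₁ ω) ≠ ω.1} ≤ thresholdError (· ≠ ·) s₁ N γ₁ x₁ ∧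
      c.law N {ω | c.dec₂ (c.Y₂ a ω) ≠ ω.2.1} ≤ thresholdError (· ≠ ·) s₂ N γ₂ x₂ +
        thresholdError (fun w w' => w.1 ≠ w'.1 ∧ w.2 ≠ w'.2) s N γ
          (fun w : Fin M₁ × Fin M₂ => x₂ w.2 + √a • x₁ w.1) := by
  obtain ⟨d₁, hd₁m, hd₁⟩ := exists_decoder (A := fun w => {y | γ₁ < infoDensity s₁ N (x₁ w) y})
    (fun w => measurableSet_lt measurable_const (by fun_prop))
  obtain ⟨d₂, hd₂m, hd₂⟩ := exists_decoder (A := fun w₂ => {y | ∃ w₁,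
      γ < infoDensity s N (x₂ w₂ + √a • x₁ w₁) y ∧
        γ₂ < infoDensity s₂ N (x₂ w₂) (y - √a • x₁ w₁)}) (fun w₂ => by
    have : {y | ∃ w₁, γ < infoDensity s N (x₂ w₂ + √a • x₁ w₁) y ∧
        γ₂ < infoDensity s₂ N (x₂ w₂) (y - √a • x₁ w₁)} =
      ⋃ w₁, ({y | γ < infoDensity s N (x₂ w₂ + √a • x₁ w₁) y} ∩
        {y | γ₂ < infoDensity s₂ N (x₂ w₂) (y - √a • x₁ w₁)}) := by
      ext y; simp
    rw [this]
    exact MeasurableSet.iUnion fun w₁ => (measurableSet_lt measurable_const (by fun_prop)).inter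
      (measurableSet_lt measurable_const (by fun_prop)))
  set c : Code n P₁ P₂ := ⟨M₁, M₂, Nat.pos_of_ne_zero (NeZero.ne M₁),
    Nat.pos_of_ne_zero (NeZero.ne M₂), x₁, x₂, h₁, h₂, d₁, d₂, hd₁m, hd₂m⟩ with hc
  refine ⟨c, rfl, rfl, ?_, ?_⟩
  · rw [c.law_error₁, thresholdError, Fintype.card_fin]
    refine mul_le_mul_right (Finset.sum_le_sum fun w _ => ?_) _
    have hsub : {z | d₁ (x₁ w + z) ≠ w} ⊆ {z | ¬ γ₁ < infoDensity s₁ N (x₁ w) (x₁ w + z)} ∪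
        ⋃ w' ∈ Finset.univ.filter (fun w' => w ≠ w'),
          {z | γ₁ < infoDensity s₁ N (x₁ w') (x₁ w + z)} := by
      intro z hz
      by_contra hcon
      simp only [Set.mem_union, Set.mem_iUnion, Finset.mem_filter, Finset.mem_univ, true_and,
        Set.mem_ofPred_eq, not_or, not_not, exists_prop, not_exists, not_and] at hcon
      exact hz (hd₁ w _ hcon.1 fun w' hw' => hcon.2 w' hw'.symm)
    exact (measure_mono hsub).trans ((measure_union_le _ _).trans
      (add_le_add le_rfl (measure_biUnion_finset_le _ _)))
  · rw [c.law_error₂]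
    have hpair : ∀ (w₁ : Fin M₁) (w₂ : Fin M₂),
        noise n N {z | d₂ (x₂ w₂ + √a • x₁ w₁ + z) ≠ w₂} ≤
          (noise n N {z | ¬ γ₂ < infoDensity s₂ N (x₂ w₂) (x₂ w₂ + z)} +
            ∑ w' with w₂ ≠ w', noise n N {z | γ₂ < infoDensity s₂ N (x₂ w') (x₂ w₂ + z)}) +
          (noise n N {z | ¬ γ < infoDensity s N (x₂ w₂ + √a • x₁ w₁)
              (x₂ w₂ + √a • x₁ w₁ + z)} +
            ∑ w' : Fin M₁ × Fin M₂ with w₁ ≠ w'.1 ∧ w₂ ≠ w'.2, noise n N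
              {z | γ < infoDensity s N (x₂ w'.2 + √a • x₁ w'.1) (x₂ w₂ + √a • x₁ w₁ + z)}) := by
      intro w₁ w₂
      have hsub : {z | d₂ (x₂ w₂ + √a • x₁ w₁ + z) ≠ w₂} ⊆
          ({z | ¬ γ₂ < infoDensity s₂ N (x₂ w₂) (x₂ w₂ + z)} ∪
            ⋃ w' ∈ Finset.univ.filter (fun w' => w₂ ≠ w'),
              {z | γ₂ < infoDensity s₂ N (x₂ w') (x₂ w₂ + z)}) ∪
          ({z | ¬ γ < infoDensity s N (x₂ w₂ + √a • x₁ w₁) (x₂ w₂ + √a • x₁ w₁ + z)} ∪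
            ⋃ w' ∈ Finset.univ.filter (fun w' : Fin M₁ × Fin M₂ => w₁ ≠ w'.1 ∧ w₂ ≠ w'.2),
              {z | γ < infoDensity s N (x₂ w'.2 + √a • x₁ w'.1)
                (x₂ w₂ + √a • x₁ w₁ + z)}) := by
        intro z hz
        by_contra hcon
        simp only [Set.mem_union, Set.mem_iUnion, Finset.mem_filter, Finset.mem_univ, true_and,
          Set.mem_ofPred_eq, not_or, not_not, exists_prop, not_exists, not_and, and_imp,
          Prod.forall] at hcon
        obtain ⟨⟨ha1, ha2⟩, ha3, ha4⟩ := hcon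
        have hcancel : x₂ w₂ + √a • x₁ w₁ + z - √a • x₁ w₁ = x₂ w₂ + z := by abel
        refine hz (hd₂ w₂ _ ⟨w₁, ha3, by rwa [hcancel]⟩ ?_)
        rintro w₂' hw₂' ⟨w₁', hb1, hb2⟩
        by_cases hw : w₁ = w₁'
        · subst hw
          rw [hcancel] at hb2
          exact ha2 w₂' hw₂'.symm hb2
        · exact ha4 w₁' w₂' hw hw₂'.symm hb1
      refine (measure_mono hsub).trans ((measure_union_le _ _).trans ?_)
      exact add_le_add ((measure_union_le _ _).trans
        (add_le_add le_rfl (measure_biUnion_finset_le _ _))) ((measure_union_le _ _).trans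
        (add_le_add le_rfl (measure_biUnion_finset_le _ _)))
    refine (mul_le_mul_right (Finset.sum_le_sum fun w₁ _ => mul_le_mul_right
      (Finset.sum_le_sum fun w₂ _ => hpair w₁ w₂) _) _).trans (le_of_eq ?_)
    have hM₁0 : (M₁ : ℝ≥0∞) ≠ 0 := by simp [NeZero.ne M₁]
    have hM₂0 : (M₂ : ℝ≥0∞) ≠ 0 := by simp [NeZero.ne M₂]
    have hM₁ : (M₁ : ℝ≥0∞) ≠ ∞ := ENNReal.natCast_ne_top _
    simp only [thresholdError, Finset.sum_add_distrib, mul_add, Fintype.sum_prod_type,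
      Fintype.card_prod, Fintype.card_fin, Nat.cast_mul, hc, Finset.sum_const, Finset.card_univ,
      nsmul_eq_mul, ← Finset.mul_sum, ← mul_assoc, ENNReal.inv_mul_cancel hM₁0 hM₁, one_mul,
      ENNReal.mul_inv (Or.inl hM₁0) (Or.inl hM₁)]

/-- White noise of power `Q` conditioned on the power constraint `P`: a random codeword which
always satisfies the constraint and whose law is dominated by that of the noise. -/
noncomputable def inputLaw (n : ℕ) (Q P : ℝ) : Measure (Fin n → ℝ) :=
  ProbabilityTheory.cond (noise n Q) {x | normSq x ≤ n * P}

lemma measurableSet_normSq_le (n : ℕ) (P : ℝ) :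
    MeasurableSet {x : Fin n → ℝ | normSq x ≤ n * P} :=
  measurableSet_le measurable_normSq measurable_const

lemma inputLaw_properties {n : ℕ} {Q P : ℝ}
    (h : noise n Q {x | normSq x ≤ n * P}ᶜ ≤ 2⁻¹) :
    IsProbabilityMeasure (inputLaw n Q P) ∧ inputLaw n Q P ≤ (2 : ℝ≥0∞) • noise n Q ∧
      ∀ᵐ x ∂inputLaw n Q P, normSq x ≤ n * P := by
  have hB := measurableSet_normSq_le n P
  have hhalf : 2⁻¹ ≤ noise n Q {x | normSq x ≤ n * P} := by
    have h1 := prob_add_prob_compl (μ := noise n Q) hB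
    by_contra! hlt
    have h2 : noise n Q {x | normSq x ≤ n * P} + noise n Q {x | normSq x ≤ n * P}ᶜ <
        2⁻¹ + 2⁻¹ := ENNReal.add_lt_add_of_lt_of_le (by finiteness) hlt h
    rw [h1, ENNReal.inv_two_add_inv_two] at h2
    exact lt_irrefl _ h2
  refine ⟨cond_isProbabilityMeasure (ne_of_gt (lt_of_lt_of_le (by simp) hhalf)), ?_,
    ae_cond_mem hB⟩
  refine Measure.le_iff.2 fun s _ => ?_
  rw [inputLaw, cond_apply hB, Measure.smul_apply, smul_eq_mul]
  gcongr
  · rw [← inv_inv (2 : ℝ≥0∞)]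
    exact ENNReal.inv_le_inv.2 hhalf
  · exact Set.inter_subset_right

lemma tendsto_noise_power_violation {Q P : ℝ} (hQ : 0 ≤ Q) (hQP : Q < P) :
    Tendsto (fun n : ℕ => noise n Q {x | normSq x ≤ n * P}ᶜ) atTop (𝓝 0) := by
  refine tendsto_of_tendsto_of_tendsto_of_le_of_le tendsto_const_nhds
    (tendsto_noise_normSq hQ (sub_pos.2 hQP)) (fun _ => zero_le) fun n => measure_mono ?_
  intro x hx
  have hx' : n * P < normSq x := not_le.1 hx
  refine le_trans ?_ (le_abs_self (normSq x - n * Q))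
  rw [mul_sub]
  linarith

/-- The sum signal of independent codewords, each dominated by white noise, is dominated by white
noise of the total power. -/
lemma map_add_smul_le {n : ℕ} {Q₁ Q₂ a : ℝ} (hQ₁ : 0 ≤ Q₁) (hQ₂ : 0 ≤ Q₂) (ha : 0 ≤ a)
    {μ₁ μ₂ : Measure (Fin n → ℝ)} [SFinite μ₁] [SFinite μ₂] (h₁ : μ₁ ≤ (2 : ℝ≥0∞) • noise n Q₁)
    (h₂ : μ₂ ≤ (2 : ℝ≥0∞) • noise n Q₂) :
    (μ₁.prod μ₂).map (fun p => p.2 + √a • p.1) ≤ (4 : ℝ≥0∞) • noise n (a * Q₁ + Q₂) := by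
  have h := Measure.map_mono (Measure.prod_mono h₁ h₂)
    (by fun_prop : Measurable fun p : (Fin n → ℝ) × (Fin n → ℝ) => p.2 + √a • p.1)
  refine h.trans (le_of_eq ?_)
  have hm := Measure.map_prod_map (noise n Q₁) (noise n Q₂)
    (f := fun x => √a • x) (g := id) (by fun_prop) measurable_id
  rw [Measure.map_id, noise_map_smul, Real.sq_sqrt ha] at hm
  have hs := noise_prod_map_add n (mul_nonneg ha hQ₁) hQ₂
  rw [hm, Measure.map_map (by fun_prop) (by fun_prop)] at hs
  have he : ((fun p : (Fin n → ℝ) × (Fin n → ℝ) => p.1 + p.2) ∘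
      Prod.map (fun x => √a • x) id) = fun p => p.2 + √a • p.1 := by
    ext p : 1
    simp [add_comm]
  rw [he] at hs
  rw [Measure.prod_smul_left, Measure.prod_smul_right, Measure.map_smul, Measure.map_smul, hs,
    smul_smul]
  norm_num

/-- Random coding: some codebook does no worse than the average. -/
lemma exists_code {n M₁ M₂ : ℕ} [NeZero M₁] [NeZero M₂] {P₁ P₂ N a Q₁ Q₂ : ℝ} (hQ₁ : 0 ≤ Q₁)
    (hQ₂ : 0 ≤ Q₂) (hN : 0 < N) (ha : 0 ≤ a) (hb₁ : noise n Q₁ {x | normSq x ≤ n * P₁}ᶜ ≤ 2⁻¹)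
    (hb₂ : noise n Q₂ {x | normSq x ≤ n * P₂}ᶜ ≤ 2⁻¹) (γ₁ γ₂ γ : ℝ) :
    ∃ c : Code n P₁ P₂, c.M₁ = M₁ ∧ c.M₂ = M₂ ∧
      c.law N {ω | c.dec₁ (c.Y₁ ω) ≠ ω.1} + c.law N {ω | c.dec₂ (c.Y₂ a ω) ≠ ω.2.1} ≤
        (2 * missProb n Q₁ N γ₁ + M₁ * (2 * ENNReal.ofReal (Real.exp (-γ₁)))) +
        ((2 * missProb n Q₂ N γ₂ + M₂ * (2 * ENNReal.ofReal (Real.exp (-γ₂)))) +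
        (4 * missProb n (a * Q₁ + Q₂) N γ +
          (M₁ * M₂ : ℕ) * (4 * ENNReal.ofReal (Real.exp (-γ))))) := by
  obtain ⟨hp₁, hle₁, hae₁⟩ := inputLaw_properties hb₁
  obtain ⟨hp₂, hle₂, hae₂⟩ := inputLaw_properties hb₂
  set μ : Fin M₁ ⊕ Fin M₂ → Measure (Fin n → ℝ) :=
    Sum.elim (fun _ => inputLaw n Q₁ P₁) (fun _ => inputLaw n Q₂ P₂) with hμ
  have hμp : ∀ i, IsProbabilityMeasure (μ i) := by rintro (i | i) <;> assumption
  set ρ := Measure.pi μ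
  -- A codebook is a point `b` of the product space; its codewords are its coordinates.
  set f : Fin M₁ ⊕ Fin M₂ → (Fin M₁ ⊕ Fin M₂ → Fin n → ℝ) → Fin n → ℝ := fun i b => b i
  have hf : ∀ i, Measurable (f i) := fun i => measurable_pi_apply i
  have hind : iIndepFun f ρ := iIndepFun_pi (X := fun _ x => x) fun _ => by fun_prop
  have hmap : ∀ i, ρ.map (f i) = μ i := fun i => (measurePreserving_eval μ i).map_eq
  have hE₁ := lintegral_thresholdError_le (R := fun w w' : Fin M₁ => w ≠ w') hQ₁ hN γ₁ (ρ := ρ)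
    (X := fun w => f (Sum.inl w)) (fun w => hf _) (K := 2)
    (fun w => by rw [hmap]; exact hle₁)
    (fun w w' hR => hind.indepFun (by simpa using Ne.symm hR))
  have hE₂ := lintegral_thresholdError_le (R := fun w w' : Fin M₂ => w ≠ w') hQ₂ hN γ₂ (ρ := ρ)
    (X := fun w => f (Sum.inr w)) (fun w => hf _) (K := 2)
    (fun w => by rw [hmap]; exact hle₂)
    (fun w w' hR => hind.indepFun (by simpa using Ne.symm hR))
  have hadd : Measurable fun p : (Fin n → ℝ) × (Fin n → ℝ) => p.2 + √a • p.1 := by fun_prop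
  have hXm : ∀ w : Fin M₁ × Fin M₂,
      Measurable fun b => f (Sum.inr w.2) b + √a • f (Sum.inl w.1) b :=
    fun w => hadd.comp ((hf (Sum.inl w.1)).prodMk (hf (Sum.inr w.2)))
  have hE := lintegral_thresholdError_le
    (R := fun w w' : Fin M₁ × Fin M₂ => w.1 ≠ w'.1 ∧ w.2 ≠ w'.2)
    (Q := a * Q₁ + Q₂) (by positivity) hN γ (ρ := ρ)
    (X := fun w b => f (Sum.inr w.2) b + √a • f (Sum.inl w.1) b) hXm (K := 4)
    (fun w => by
      have h1 := (indepFun_iff_map_prod_eq_prod_map_map (hf (Sum.inl w.1)).aemeasurable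
        (hf (Sum.inr w.2)).aemeasurable).1 (hind.indepFun (by simp))
      rw [hmap, hmap] at h1
      have h2 := map_add_smul_le hQ₁ hQ₂ ha hle₁ hle₂
      have h3 : (μ (Sum.inl w.1)).prod (μ (Sum.inr w.2)) =
        (inputLaw n Q₁ P₁).prod (inputLaw n Q₂ P₂) := rfl
      rw [← h3, ← h1, Measure.map_map hadd ((hf _).prodMk (hf _))] at h2
      exact h2)
    (fun w w' hR => (hind.indepFun_prodMk_prodMk hf (Sum.inl w'.1) (Sum.inr w'.2) (Sum.inl w.1)
      (Sum.inr w.2) (by simpa using hR.1.symm) (by simp) (by simp)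
      (by simpa using hR.2.symm)).comp hadd hadd)
  have hT₁ := measurable_thresholdError (R := fun w w' : Fin M₁ => w ≠ w') (s := Q₁ + N) (N := N)
    (γ := γ₁) (fun w => hf (Sum.inl w))
  have hT₂ := measurable_thresholdError (R := fun w w' : Fin M₂ => w ≠ w') (s := Q₂ + N) (N := N)
    (γ := γ₂) (fun w => hf (Sum.inr w))
  have hT := measurable_thresholdError
    (R := fun w w' : Fin M₁ × Fin M₂ => w.1 ≠ w'.1 ∧ w.2 ≠ w'.2) (s := a * Q₁ + Q₂ + N) (N := N)
    (γ := γ) hXm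
  have hgood : ∀ᵐ b ∂ρ, (∀ w, normSq (f (Sum.inl w) b) ≤ n * P₁) ∧
      ∀ w, normSq (f (Sum.inr w) b) ≤ n * P₂ := by
    refine (ae_all_iff.2 fun w => ?_).and (ae_all_iff.2 fun w => ?_)
    · have h := hmap (Sum.inl w)
      exact ae_of_ae_map (hf _).aemeasurable (by rw [h]; exact hae₁)
    · have h := hmap (Sum.inr w)
      exact ae_of_ae_map (hf _).aemeasurable (by rw [h]; exact hae₂)
  obtain ⟨b, hb, hble⟩ := exists_notMem_null_le_lintegral (μ := ρ)
    (hT₁.add (hT₂.add hT)).aemeasurable hgood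
  simp only [not_not, Set.mem_compl_iff, Set.mem_ofPred_eq, Pi.add_apply] at hb hble
  rw [lintegral_add_left hT₁, lintegral_add_left hT₂] at hble
  obtain ⟨c, hc₁, hc₂, he₁, he₂⟩ := exists_code_of_codebook N a hb.1 hb.2 (Q₁ + N) (Q₂ + N)
    (a * Q₁ + Q₂ + N) γ₁ γ₂ γ
  refine ⟨c, hc₁, hc₂, (add_le_add he₁ he₂).trans (hble.trans ?_)⟩
  simp only [Fintype.card_fin, Fintype.card_prod] at hE₁ hE₂ hE
  exact add_le_add hE₁ (add_le_add hE₂ hE)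

/-! ### Achievable rate pairs -/

/-- The number of messages used for the rate `r` at block length `n`. -/
noncomputable def numMessages (n : ℕ) (r : ℝ) : ℕ := ⌊Real.exp (n * r)⌋₊ + 1

instance (n : ℕ) (r : ℝ) : NeZero (numMessages n r) := ⟨Nat.succ_ne_zero _⟩

lemma exp_le_numMessages (n : ℕ) (r : ℝ) : Real.exp (n * r) ≤ numMessages n r := by
  rw [numMessages]; push_cast; exact (Nat.lt_floor_add_one _).le

lemma numMessages_le {n : ℕ} {r : ℝ} (hr : 0 ≤ r) :
    (numMessages n r : ℝ) ≤ 2 * Real.exp (n * r) := by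
  have h1 := Nat.floor_le (Real.exp_pos (n * r)).le
  have h2 : 1 ≤ Real.exp (n * r) := Real.one_le_exp (by positivity)
  rw [numMessages]; push_cast; linarith

lemma abs_log_numMessages_sub_le {n : ℕ} (hn : 1 ≤ n) {r : ℝ} (hr : 0 ≤ r) :
    |Real.log (numMessages n r) / n - r| ≤ Real.log 2 / n := by
  have hn' : (0 : ℝ) < n := by exact_mod_cast hn
  have hpos : (0 : ℝ) < numMessages n r := (Real.exp_pos _).trans_le (exp_le_numMessages n r)
  have h1 := Real.log_le_log (Real.exp_pos _) (exp_le_numMessages n r)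
  have h2 := Real.log_le_log hpos (numMessages_le (n := n) hr)
  rw [Real.log_mul two_ne_zero (Real.exp_pos _).ne'] at h2
  rw [Real.log_exp] at h1 h2
  have e : Real.log (numMessages n r) / n - r = (Real.log (numMessages n r) - n * r) / n := by
    field_simp
  rw [e, abs_div, abs_of_pos hn']
  gcongr
  exact abs_le.2 ⟨by linarith [Real.log_nonneg one_le_two], by linarith⟩

lemma tendsto_exp_neg_mul {η : ℝ} (hη : 0 < η) (K : ℝ≥0∞) (hK : K ≠ ∞) :
    Tendsto (fun n : ℕ => K * ENNReal.ofReal (Real.exp (-(n * η)))) atTop (𝓝 0) := by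
  have h1 : Tendsto (fun n : ℕ => (n : ℝ) * η) atTop atTop :=
    tendsto_natCast_atTop_atTop.atTop_mul_const hη
  have h2 := ENNReal.tendsto_ofReal (Real.tendsto_exp_neg_atTop_nhds_zero.comp h1)
  simpa using ENNReal.Tendsto.const_mul h2 (Or.inr hK)

/-- A message set of rate below the threshold by `η` contributes a vanishing error. -/
lemma natCast_mul_exp_le {n M : ℕ} {k r η C : ℝ} (K : ℝ≥0∞) (hk : 0 ≤ k)
    (hM : (M : ℝ) ≤ k * Real.exp (n * r)) (h : r + 2 * η ≤ C) :
    (M : ℝ≥0∞) * (K * ENNReal.ofReal (Real.exp (-(n * (C - η))))) ≤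
      (K * ENNReal.ofReal k) * ENNReal.ofReal (Real.exp (-(n * η))) := by
  rw [← ENNReal.ofReal_natCast, mul_left_comm, mul_assoc, ← ENNReal.ofReal_mul (Nat.cast_nonneg _),
    ← ENNReal.ofReal_mul hk]
  refine mul_le_mul_right (ENNReal.ofReal_le_ofReal ?_) K
  calc (M : ℝ) * Real.exp (-(n * (C - η)))
      ≤ k * Real.exp (n * r) * Real.exp (-(n * (C - η))) := by gcongr
    _ = k * Real.exp (n * r + -(n * (C - η))) := by rw [mul_assoc, Real.exp_add]
    _ ≤ k * Real.exp (-(n * η)) := by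
        gcongr
        have := mul_le_mul_of_nonneg_left h (Nat.cast_nonneg (α := ℝ) n)
        linarith

/-- Rate pairs well inside the region of the multiple-access channel with powers `Q₁ < P₁` and
`Q₂ < P₂` are attained with vanishing error. -/
lemma eventually_exists_code {P₁ P₂ N a Q₁ Q₂ r₁ r₂ η ε : ℝ} (hQ₁ : 0 ≤ Q₁) (hQ₂ : 0 ≤ Q₂)
    (hQP₁ : Q₁ < P₁) (hQP₂ : Q₂ < P₂) (hN : 0 < N) (ha : 0 ≤ a) (hη : 0 < η) (hε : 0 < ε)
    (hr₁ : 0 ≤ r₁) (hr₂ : 0 ≤ r₂) (h₁ : r₁ + 2 * η ≤ capacity Q₁ N)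
    (h₂ : r₂ + 2 * η ≤ capacity Q₂ N) (h : r₁ + r₂ + 2 * η ≤ capacity (a * Q₁ + Q₂) N) :
    ∀ᶠ n : ℕ in atTop, ∃ c : Code n P₁ P₂, c.error₁ N ≤ ε ∧ c.error₂ N a ≤ ε ∧
      |c.R₁ - r₁| ≤ ε ∧ |c.R₂ - r₂| ≤ ε := by
  set γ₁ : ℕ → ℝ := fun n => n * (capacity Q₁ N - η)
  set γ₂ : ℕ → ℝ := fun n => n * (capacity Q₂ N - η)
  set γ : ℕ → ℝ := fun n => n * (capacity (a * Q₁ + Q₂) N - η)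
  set B : ℕ → ℝ≥0∞ := fun n =>
    (2 * missProb n Q₁ N (γ₁ n) + (2 * ENNReal.ofReal 2) * ENNReal.ofReal (Real.exp (-(n * η)))) +
    ((2 * missProb n Q₂ N (γ₂ n) + (2 * ENNReal.ofReal 2) * ENNReal.ofReal (Real.exp (-(n * η)))) +
    (4 * missProb n (a * Q₁ + Q₂) N (γ n) +
      (4 * ENNReal.ofReal 4) * ENNReal.ofReal (Real.exp (-(n * η)))))
  have hB : Tendsto B atTop (𝓝 0) := by
    have m (K : ℝ≥0∞) (hK : K ≠ ∞) {Q : ℝ} (hQ : 0 ≤ Q) :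
        Tendsto (fun n : ℕ => K * missProb n Q N (n * (capacity Q N - η))) atTop (𝓝 0) := by
      simpa using ENNReal.Tendsto.const_mul (tendsto_missProb hQ hN hη) (Or.inr hK)
    have h1 := ((m 2 (by simp) hQ₁).add
      (tendsto_exp_neg_mul hη (2 * ENNReal.ofReal 2) (by finiteness))).add
      (((m 2 (by simp) hQ₂).add (tendsto_exp_neg_mul hη (2 * ENNReal.ofReal 2) (by finiteness))).add
      ((m 4 (by simp) (Q := a * Q₁ + Q₂) (by positivity)).add
        (tendsto_exp_neg_mul hη (4 * ENNReal.ofReal 4) (by finiteness))))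
    simpa only [add_zero] using h1
  have hhalf : (0 : ℝ≥0∞) < 2⁻¹ := by simp
  filter_upwards [(tendsto_noise_power_violation hQ₁ hQP₁).eventually_le_const hhalf,
    (tendsto_noise_power_violation hQ₂ hQP₂).eventually_le_const hhalf,
    hB.eventually_le_const (ENNReal.ofReal_pos.2 hε), eventually_ge_atTop 1,
    (tendsto_const_div_atTop_nhds_zero_nat (Real.log 2)).eventually_le_const hε]
    with n hb₁ hb₂ hBn hn hlog
  obtain ⟨c, hc₁, hc₂, hc⟩ := exists_code (M₁ := numMessages n r₁) (M₂ := numMessages n r₂)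
    hQ₁ hQ₂ hN ha hb₁ hb₂ (γ₁ n) (γ₂ n) (γ n)
  have hM : ((numMessages n r₁ * numMessages n r₂ : ℕ) : ℝ) ≤ 4 * Real.exp (n * (r₁ + r₂)) := by
    have := mul_le_mul (numMessages_le (n := n) hr₁) (numMessages_le (n := n) hr₂)
      (Nat.cast_nonneg _) (by positivity)
    push_cast
    refine this.trans (le_of_eq ?_)
    rw [mul_add, Real.exp_add]
    ring
  have hle : c.law N {ω | c.dec₁ (c.Y₁ ω) ≠ ω.1} + c.law N {ω | c.dec₂ (c.Y₂ a ω) ≠ ω.2.1} ≤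
      ENNReal.ofReal ε := by
    refine (hc.trans ?_).trans hBn
    exact add_le_add
      (add_le_add le_rfl (natCast_mul_exp_le 2 zero_le_two (numMessages_le hr₁) h₁))
      (add_le_add
        (add_le_add le_rfl (natCast_mul_exp_le 2 zero_le_two (numMessages_le hr₂) h₂))
        (add_le_add le_rfl (natCast_mul_exp_le 4 zero_le_four hM h)))
  refine ⟨c, ?_, ?_, ?_, ?_⟩
  · exact ENNReal.toReal_le_of_le_ofReal hε.le (le_self_add.trans hle)
  · exact ENNReal.toReal_le_of_le_ofReal hε.le (le_add_self.trans hle)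
  · rw [Code.R₁, hc₁]
    exact (abs_log_numMessages_sub_le hn hr₁).trans hlog
  · rw [Code.R₂, hc₂]
    exact (abs_log_numMessages_sub_le hn hr₂).trans hlog

/-- A diagonal argument: a rate pair that can be approached within every tolerance belongs to the
capacity region. The `n`-th code nearly minimizes the total deviation. -/
lemma mem_capacityRegion_of_eventually {P₁ P₂ N a : ℝ} (hP₁ : 0 ≤ P₁) (hP₂ : 0 ≤ P₂) {R : ℝ × ℝ}
    (h : ∀ ε > 0, ∀ᶠ n : ℕ in atTop, ∃ c : Code n P₁ P₂, c.error₁ N ≤ ε ∧ c.error₂ N a ≤ ε ∧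
      |c.R₁ - R.1| ≤ ε ∧ |c.R₂ - R.2| ≤ ε) :
    R ∈ capacityRegion P₁ P₂ N a := by
  have hne : ∀ n, Nonempty (Code n P₁ P₂) := fun n =>
    ⟨⟨1, 1, one_pos, one_pos, fun _ => 0, fun _ => 0, fun _ => by simp; positivity,
      fun _ => by simp; positivity, fun _ => 0, fun _ => 0, measurable_const, measurable_const⟩⟩
  set J : (n : ℕ) → Code n P₁ P₂ → ℝ := fun n c =>
    c.error₁ N + c.error₂ N a + |c.R₁ - R.1| + |c.R₂ - R.2| with hJ
  have he₁ : ∀ n (c : Code n P₁ P₂), 0 ≤ c.error₁ N := fun n c => measureReal_nonneg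
  have he₂ : ∀ n (c : Code n P₁ P₂), 0 ≤ c.error₂ N a := fun n c => measureReal_nonneg
  have hJ0 : ∀ n c, 0 ≤ J n c := fun n c => by
    have := he₁ n c; have := he₂ n c; positivity
  have hbdd : ∀ n, BddBelow (Set.range (J n)) := fun n => ⟨0, by rintro _ ⟨c, rfl⟩; exact hJ0 n c⟩
  have hex : ∀ n : ℕ, ∃ c, J n c < (⨅ c, J n c) + 1 / (n + 1) := fun n =>
    have := hne n
    exists_lt_of_ciInf_lt (lt_add_of_pos_right _ (by positivity))
  choose c hc using hex
  have hinf : Tendsto (fun n => ⨅ c, J n c) atTop (𝓝 0) := by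
    refine tendsto_order.2 ⟨fun x hx => Eventually.of_forall fun n => hx.trans_le
      (Real.iInf_nonneg (hJ0 n)), fun x hx => ?_⟩
    filter_upwards [h (x / 5) (by positivity)] with n ⟨c, h1, h2, h3, h4⟩
    refine (ciInf_le (hbdd n) c).trans_lt ?_
    simp only [hJ]
    linarith
  have hlim : Tendsto (fun n => J n (c n)) atTop (𝓝 0) := by
    refine squeeze_zero (fun n => hJ0 n _) (fun n => (hc n).le) ?_
    simpa using hinf.add (tendsto_one_div_add_atTop_nhds_zero_nat (𝕜 := ℝ))
  have hb : ∀ n, (c n).error₁ N ≤ J n (c n) ∧ (c n).error₂ N a ≤ J n (c n) ∧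
      |(c n).R₁ - R.1| ≤ J n (c n) ∧ |(c n).R₂ - R.2| ≤ J n (c n) := fun n => by
    have h1 := he₁ n (c n)
    have h2 := he₂ n (c n)
    have h3 := abs_nonneg ((c n).R₁ - R.1)
    have h4 := abs_nonneg ((c n).R₂ - R.2)
    simp only [hJ]
    exact ⟨by linarith, by linarith, by linarith, by linarith⟩
  refine ⟨c, ⟨squeeze_zero (fun n => he₁ n _) (fun n => (hb n).1) hlim,
    squeeze_zero (fun n => he₂ n _) (fun n => (hb n).2.1) hlim⟩, ?_⟩
  refine Tendsto.prodMk_nhds ?_ ?_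
  · exact tendsto_iff_norm_sub_tendsto_zero.2
      (squeeze_zero (fun _ => norm_nonneg _) (fun n => (hb n).2.2.1) hlim)
  · exact tendsto_iff_norm_sub_tendsto_zero.2
      (squeeze_zero (fun _ => norm_nonneg _) (fun n => (hb n).2.2.2) hlim)

lemma eventually_capacity_scaled_ge {P N η : ℝ} (hP : 0 ≤ P) (hN : 0 < N) (hη : 0 < η) :
    ∀ᶠ t in 𝓝[<] (1 : ℝ), capacity P N - η ≤ capacity (t * P) N := by
  have hc : ContinuousAt (fun t : ℝ => capacity (t * P) N) 1 := by
    unfold capacity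
    refine ContinuousAt.mul continuousAt_const (ContinuousAt.log (by fun_prop) ?_)
    positivity
  have h := hc.eventually (lt_mem_nhds (show capacity P N - η < capacity (1 * P) N by
    rw [one_mul]; linarith))
  exact (h.filter_mono nhdsWithin_le_nhds).mono fun t ht => ht.le

/-- Every pair of positive rates in the pentagon cut out by the two interference-free capacities and
the sum capacity at the second receiver is achievable. -/
lemma mem_capacityRegion {P₁ P₂ N a : ℝ} (hP₁ : 0 < P₁) (hP₂ : 0 < P₂) (hN : 0 < N) (ha : 0 ≤ a)
    {R₁ R₂ : ℝ} (hR₁ : 0 < R₁) (hR₂ : 0 < R₂) (h₁ : R₁ ≤ capacity P₁ N) (h₂ : R₂ ≤ capacity P₂ N)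
    (h : R₁ + R₂ ≤ capacity (a * P₁ + P₂) N) :
    (R₁, R₂) ∈ capacityRegion P₁ P₂ N a := by
  refine mem_capacityRegion_of_eventually hP₁.le hP₂.le fun ε hε => ?_
  -- The rates are lowered by `3η`, of which `η` pays for the reduction of the powers.
  set η := min (ε / 6) (min (R₁ / 3) (R₂ / 3)) with hη
  have hη0 : 0 < η := by positivity
  have hη1 : η ≤ ε / 6 := min_le_left _ _
  have hη2 : η ≤ R₁ / 3 := (min_le_right _ _).trans (min_le_left _ _)
  have hη3 : η ≤ R₂ / 3 := (min_le_right _ _).trans (min_le_right _ _)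
  obtain ⟨t, ht₁, ht₂, ht, ht1, ht0⟩ := ((eventually_capacity_scaled_ge hP₁.le hN hη0).and
    ((eventually_capacity_scaled_ge hP₂.le hN hη0).and
    ((eventually_capacity_scaled_ge (P := a * P₁ + P₂) (by positivity) hN hη0).and
    (eventually_mem_nhdsWithin.and (eventually_nhdsWithin_of_eventually_nhds
      (lt_mem_nhds (zero_lt_one (α := ℝ)))))))).exists
  have ht1' : t < 1 := ht1
  have htS : t * (a * P₁ + P₂) = a * (t * P₁) + t * P₂ := by ring
  rw [htS] at ht
  have key := eventually_exists_code (P₁ := P₁) (P₂ := P₂) (N := N) (a := a) (Q₁ := t * P₁)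
    (Q₂ := t * P₂) (r₁ := R₁ - 3 * η) (r₂ := R₂ - 3 * η) (η := η) (ε := ε / 2) (by positivity)
    (by positivity) (by nlinarith) (by nlinarith) hN ha hη0 (by positivity) (by linarith)
    (by linarith) (by linarith) (by linarith) (by linarith)
  filter_upwards [key] with n ⟨c, he₁, he₂, hr₁, hr₂⟩
  refine ⟨c, by linarith, by linarith, ?_, ?_⟩
  · rw [abs_le] at hr₁ ⊢
    constructor <;> linarith [hr₁.1, hr₁.2]
  · rw [abs_le] at hr₂ ⊢
    constructor <;> linarith [hr₂.1, hr₂.2]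

/-! ### The corner points -/

lemma half_log_sub_capacity {S P N x : ℝ} (hS : 0 < 1 + S / N) (hP : 0 < 1 + P / N)
    (h : (1 + S / N) / (1 + P / N) = 1 + x) :
    1 / 2 * Real.log (1 + S / N) - capacity P N = 1 / 2 * Real.log (1 + x) := by
  rw [capacity, ← mul_sub, ← Real.log_div hS.ne' hP.ne', h]

end GaussianZIC

theorem proposition1 (P₁ P₂ N a : ℝ) (hP₁ : 0 < P₁) (hP₂ : 0 < P₂) (hN : 0 < N)
    (ha : 1 ≤ a) (ha' : a ≤ 1 + P₂ / N) :
    (GaussianZIC.IsCornerPointAtC₂ P₁ P₂ N a (1 / 2 * Real.log (1 + a * P₁ / (P₂ + N))) ∧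
      1 / 2 * Real.log (1 + (a * P₁ + P₂) / N) - GaussianZIC.capacity P₂ N =
        1 / 2 * Real.log (1 + a * P₁ / (P₂ + N))) ∧
    (GaussianZIC.IsCornerPointAtC₁ P₁ P₂ N a
        (1 / 2 * Real.log (1 + ((a - 1) * P₁ + P₂) / (P₁ + N))) ∧
      1 / 2 * Real.log (1 + (a * P₁ + P₂) / N) - GaussianZIC.capacity P₁ N =
        1 / 2 * Real.log (1 + ((a - 1) * P₁ + P₂) / (P₁ + N))) := by
  open GaussianZIC in
  have ha0 : 0 < a := by linarith
  have ha1 : 0 ≤ a - 1 := by linarith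
  have e₂ : 1 / 2 * Real.log (1 + (a * P₁ + P₂) / N) - capacity P₂ N =
      1 / 2 * Real.log (1 + a * P₁ / (P₂ + N)) :=
    half_log_sub_capacity (by positivity) (by positivity) (by field_simp; ring)
  have e₁ : 1 / 2 * Real.log (1 + (a * P₁ + P₂) / N) - capacity P₁ N =
      1 / 2 * Real.log (1 + ((a - 1) * P₁ + P₂) / (P₁ + N)) :=
    half_log_sub_capacity (by positivity) (by positivity) (by field_simp; ring)
  have hcap : ∀ P, 0 < P → 0 < capacity P N := fun P hP =>
    mul_pos (by norm_num) (Real.log_pos (by linarith [div_pos hP hN]))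
  -- Both corner points respect the two single-user bounds because `a ≤ 1 + P₂ / N`.
  have hsum : capacity (a * P₁ + P₂) N ≤ capacity P₁ N + capacity P₂ N := by
    unfold capacity
    rw [← mul_add, ← Real.log_mul (by positivity) (by positivity)]
    gcongr
    have h : a * (P₁ / N) ≤ (1 + P₂ / N) * (P₁ / N) := by gcongr
    have h2 : (a * P₁ + P₂) / N = a * (P₁ / N) + P₂ / N := by ring
    rw [h2]
    linarith
  have hS : capacity (a * P₁ + P₂) N = 1 / 2 * Real.log (1 + (a * P₁ + P₂) / N) := rfl
  refine ⟨⟨⟨?_, fun c hc h => ?_⟩, e₂⟩, ⟨⟨?_, fun c hc h => ?_⟩, e₁⟩⟩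
  · refine mem_capacityRegion hP₁ hP₂ hN ha0.le (mul_pos (by norm_num) (Real.log_pos ?_))
      (hcap P₂ hP₂) ?_ le_rfl ?_
    · have : 0 < a * P₁ / (P₂ + N) := by positivity
      linarith
    · linarith
    · linarith
  · rw [← e₂]
    exact hc.almostLE_R₁ hP₁.le hP₂.le hN ha h
  · refine mem_capacityRegion hP₁ hP₂ hN ha0.le (hcap P₁ hP₁)
      (mul_pos (by norm_num) (Real.log_pos ?_)) le_rfl ?_ ?_
    · have : 0 < ((a - 1) * P₁ + P₂) / (P₁ + N) := by positivity
      linarith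
    · linarith
    · linarith
  · rw [← e₁]
    exact hc.almostLE_R₂ hP₁.le hP₂.le hN ha h
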